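/- Let $X_i=(X_{i,1},X_{i,2})$, $i\ge 1$, be i.i.d. bivariate normal with $\mathbb E X_{i,j}=\mu_j$, standard deviations $\sigma_1,\sigma_2>0$, covariance $r$ and correlation $\rho=r/(\sigma_1\sigma_2)\in(-1,1)$. Let $\alpha\in\mathbb R^2\setminus\{0\}$, $0\le a<b\le 1$, and $Y_i=\alpha_1X_{i,1}+\alpha_2X_{i,2}$. Let $A=\{y\in\mathbb R: F_Y^{-1}(a)<y<F_Y^{-1}(b)\}$, where $F_Y$ is the distribution function of $Y_1$ and $F_Y^{-1}(0)=-\infty$, $F_Y^{-1}(1)=+\infty$. Put $$\mu_{A,j}=\mathbb E[X_{1,j}\mid Y_1\in A],\qquad r_A=\operatorname{Cov}[X_{1,1},X_{1,2}\mid Y_1\in A].$$ For a sample of size $n$ let $X_{(i)}$ be the observation with the $i$-th smallest value of $Y$, let $m_n=[nb]-[na]$, and $$\hat\mu_{A,j}=\frac1{m_n}\sum_{i=[na]+1}^{[nb]}X_{(i),j},\qquad \hat r_A=\frac1{m_n}\sum_{i=[na]+1}^{[nb]}(X_{(i),1}-\hat\mu_{A,1})(X_{(i),2}-\hat\mu_{A,2}).$$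 Let $U_i=\operatorname{Cov}(Y_1,X_{1,2})X_{i,1}-\operatorname{Cov}(Y_1,X_{1,1})X_{i,2}$, and let $V_i$ and $W_i$ be the standardisations of $Y_i$ and $U_i$. Let $\Phi$ be the standard normal distribution function, with $\Phi^{-1}(0)=-\infty$ and $\Phi^{-1}(1)=+\infty$. Put $A_V=\{v\in\mathbb R:\Phi^{-1}(a)<v<\Phi^{-1}(b)\}$ and $\lambda_{A,k}=\mathbb E[V_1^k\mid V_1\in A_V]$ for $k=1,2$. Let $Z^A_i=(Z^A_{i,1},\dots,Z^A_{i,5})$, where, with the convention $0\cdot\infty=0$, $$Z^A_{i,k}=(V_i^k-\lambda_{A,k})1_{\{V_i\in A_V\}}+(1_{\{V_i\le\Phi^{-1}(a)\}}-a)\big(\Phi^{-1}(a)^k-\lambda_{A,k}\big)+(b-1_{\{V_i\le\Phi^{-1}(b)\}})\big(\Phi^{-1}(b)^k-\lambda_{A,k}\big),\quad k=1,2,$$ $$Z^A_{i,3}=V_iW_i1_{\{V_i\in A_V\}},\qquad Z^A_{i,4}=W_i1_{\{V_i\in A_V\}},\qquad Z^A_{i,5}=(W_i^2-1)1_{\{V_i\in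 A_V\}}.$$ Let $\Sigma^A(k,l)=(b-a)^{-2}\operatorname{Cov}[Z^A_{1,k},Z^A_{1,l}]$, $k,l=1,\dots,5$. Proposition. The matrix $\Sigma^A$ is positive semidefinite. There are $\gamma_1,\gamma_2\in[-\pi,\pi)$ with $X_{i,j}=\mu_j+\sigma_j(\cos(\gamma_j)V_i+\sin(\gamma_j)W_i)$ for all $i$ and $j$. If $(J_{A,1},J_{A,2},B_{A,1},B_{A,2},B_{A,3})$ is a centred normal random vector with covariance matrix $\Sigma^A$, then, as $n\to\infty$, $$\frac{\sqrt n}{m_n}\sum_{i=1}^nZ^A_i\xrightarrow{d}(J_{A,1},J_{A,2},B_{A,1},B_{A,2},B_{A,3}),$$ $$\sqrt n(\hat\mu_{A,j}-\mu_{A,j})\xrightarrow{d}\sigma_j\big(\cos(\gamma_j)J_{A,1}+\sin(\gamma_j)B_{A,2}\big),\qquad j=1,2,$$ $$\sqrt n(\hat r_A-r_A)\xrightarrow{d}\sigma_1\sigma_2\Big(\cos(\gamma_1)\cos(\gamma_2)(J_{A,2}-2\lambda_{A,1}J_{A,1})+\sin(\gamma_1+\gamma_2)(B_{A,1}-\lambda_{A,1}B_{A,2})+\sin(\gamma_1)\sin(\gamma_2)B_{A,3}\Big).$$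 In particular, the limits of $\sqrt n(\hat\mu_{A,j}-\mu_{A,j})$ and $\sqrt n(\hat r_A-r_A)$ are normally distributed. -/

import Mathlib

open MeasureTheory ProbabilityTheory Filter

noncomputable section

namespace QuantileCov

/-! ### Quantiles and quantile conditioning sets -/

/-- The generalised inverse of the distribution function of `ν`, with values in the extended reals:
the infimum of all real `x` with `p ≤ F(x)`. It is `-∞` for `p = 0`, and for a law with
full support it is `+∞` for `p = 1`. -/
def quantile (ν : Measure ℝ) (p : ℝ) : EReal :=
  sInf ((fun x : ℝ => (x : EReal)) '' {x : ℝ | p ≤ cdf ν x})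

/-- The quantile set of all real `y` with `F⁻¹(a) < y < F⁻¹(b)`. -/
def quantileSet (ν : Measure ℝ) (a b : ℝ) : Set ℝ :=
  {y : ℝ | quantile ν a < (y : EReal) ∧ (y : EReal) < quantile ν b}

/-- The quantile function of the standard normal law. -/
def PhiInv (p : ℝ) : EReal := quantile (gaussianReal 0 1) p

/-- The set `A_V` of all `v` with `Φ⁻¹(a) < v < Φ⁻¹(b)`. -/
def setAV (a b : ℝ) : Set ℝ := quantileSet (gaussianReal 0 1) a b

/-- The indicator of `v ≤ Φ⁻¹(p)`. -/
def indLe (p v : ℝ) : ℝ := Set.indicator {v : ℝ | (v : EReal) ≤ PhiInv p} 1 v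

/-! ### Subsamples ranked by a benchmark -/

/-- The number `[nb] - [na]` of elements of the ranked subsample. -/
def subsampleSize (a b : ℝ) (n : ℕ) : ℕ := ⌊(n : ℝ) * b⌋₊ - ⌊(n : ℝ) * a⌋₊

/-- The average of `z` over the subsample of ranks `[na]+1, …, [nb]`, where the ranking is the one
of the benchmark values `y`. Ranks are counted from `0` here, and `Tuple.sort y i` is the index of
the `i`-th smallest benchmark value. -/
def rankedMean (a b : ℝ) {n : ℕ} (y z : Fin n → ℝ) : ℝ :=
  (1 / (subsampleSize a b n : ℝ)) *
    ∑ i ∈ Finset.univ.filter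
      (fun i : Fin n => ⌊(n : ℝ) * a⌋₊ ≤ i.val ∧ i.val < ⌊(n : ℝ) * b⌋₊), z (Tuple.sort y i)

variable {Ω : Type*} [MeasurableSpace Ω]

/-- The benchmark `Y_i = α₁ X_{i,1} + α₂ X_{i,2}`. -/
def benchmark (α : Fin 2 → ℝ) (X : ℕ → Ω → EuclideanSpace ℝ (Fin 2)) (i : ℕ) (ω : Ω) : ℝ :=
  α 0 * X i ω 0 + α 1 * X i ω 1

/-- The sample conditional mean of coordinate `j`. -/
def sampleMean (α : Fin 2 → ℝ) (X : ℕ → Ω → EuclideanSpace ℝ (Fin 2)) (a b : ℝ) (j : Fin 2)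
    (n : ℕ) (ω : Ω) : ℝ :=
  rankedMean a b (fun k : Fin n => benchmark α X k ω) (fun k : Fin n => X k ω j)

/-- The sample conditional covariance. -/
def sampleCov (α : Fin 2 → ℝ) (X : ℕ → Ω → EuclideanSpace ℝ (Fin 2)) (a b : ℝ)
    (n : ℕ) (ω : Ω) : ℝ :=
  rankedMean a b (fun k : Fin n => benchmark α X k ω)
    (fun k : Fin n =>
      (X k ω 0 - sampleMean α X a b 0 n ω) * (X k ω 1 - sampleMean α X a b 1 n ω))

/-! ### Population conditional moments -/

/-- The law of the population conditioned on the event `Y ∈ A(a,b)`. -/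
def condLaw (P : Measure Ω) (α : Fin 2 → ℝ) (X : ℕ → Ω → EuclideanSpace ℝ (Fin 2))
    (a b : ℝ) : Measure Ω :=
  ProbabilityTheory.cond P
    {ω | benchmark α X 0 ω ∈ quantileSet (P.map (benchmark α X 0)) a b}

/-- The conditional mean `E[X_j | Y ∈ A]`. -/
def condMean (P : Measure Ω) (α : Fin 2 → ℝ) (X : ℕ → Ω → EuclideanSpace ℝ (Fin 2))
    (a b : ℝ) (j : Fin 2) : ℝ :=
  ∫ ω, X 0 ω j ∂(condLaw P α X a b)

/-- The conditional covariance `Cov[X_1, X_2 | Y ∈ A]`. -/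
def condCov (P : Measure Ω) (α : Fin 2 → ℝ) (X : ℕ → Ω → EuclideanSpace ℝ (Fin 2))
    (a b : ℝ) : ℝ :=
  covariance (fun ω => X 0 ω 0) (fun ω => X 0 ω 1) (condLaw P α X a b)

/-! ### The independent standardised pair -/

/-- `U_i = Cov(Y, X_2) X_{i,1} - Cov(Y, X_1) X_{i,2}`. -/
def auxU (P : Measure Ω) (α : Fin 2 → ℝ) (X : ℕ → Ω → EuclideanSpace ℝ (Fin 2))
    (i : ℕ) (ω : Ω) : ℝ :=
  covariance (benchmark α X 0) (fun ω => X 0 ω 1) P * X i ω 0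
    - covariance (benchmark α X 0) (fun ω => X 0 ω 0) P * X i ω 1

/-- The standardisation `(T - E T) / σ(T)`. -/
def standardize (P : Measure Ω) (T : Ω → ℝ) (ω : Ω) : ℝ :=
  (T ω - ∫ ω', T ω' ∂P) / Real.sqrt (variance T P)

/-- The standardised benchmark `V_i`. -/
def stdV (P : Measure Ω) (α : Fin 2 → ℝ) (X : ℕ → Ω → EuclideanSpace ℝ (Fin 2))
    (i : ℕ) : Ω → ℝ :=
  standardize P (benchmark α X i)

/-- The standardised complement `W_i`. -/
def stdW (P : Measure Ω) (α : Fin 2 → ℝ) (X : ℕ → Ω → EuclideanSpace ℝ (Fin 2))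
    (i : ℕ) : Ω → ℝ :=
  standardize P (auxU P α X i)

/-- `λ_{A,k} = E[V^k | V ∈ A_V]`. -/
def lam (P : Measure Ω) (α : Fin 2 → ℝ) (X : ℕ → Ω → EuclideanSpace ℝ (Fin 2))
    (a b : ℝ) (k : ℕ) : ℝ :=
  ∫ ω, stdV P α X 0 ω ^ k ∂(ProbabilityTheory.cond P {ω | stdV P α X 0 ω ∈ setAV a b})

/-! ### The representation variables and the limiting covariance -/

/-- The representation of the centred trimmed sum of `V^k`:
`(V^k - λ) 1{V ∈ A_V} + (1{V ≤ Φ⁻¹(a)} - a) (Φ⁻¹(a)^k - λ) + (b - 1{V ≤ Φ⁻¹(b)}) (Φ⁻¹(b)^k - λ)`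
at the point `V = v`. If `a = 0` (or `b = 1`) then the first factor of the corresponding term
is `0`, so that the term vanishes, which is the convention `0 · ∞ = 0`. -/
def trimRep (a b : ℝ) (k : ℕ) (l v : ℝ) : ℝ :=
  Set.indicator (setAV a b) (fun v => v ^ k - l) v
    + (indLe a v - a) * ((PhiInv a).toReal ^ k - l)
    + (b - indLe b v) * ((PhiInv b).toReal ^ k - l)

/-- The vector `Z_i^A` of the five representation variables. -/
def repZ (P : Measure Ω) (α : Fin 2 → ℝ) (X : ℕ → Ω → EuclideanSpace ℝ (Fin 2))
    (a b : ℝ) (i : ℕ) (ω : Ω) : EuclideanSpace ℝ (Fin 5) :=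
  !₂[trimRep a b 1 (lam P α X a b 1) (stdV P α X i ω),
    trimRep a b 2 (lam P α X a b 2) (stdV P α X i ω),
    Set.indicator (setAV a b) (fun v => v * stdW P α X i ω) (stdV P α X i ω),
    Set.indicator (setAV a b) (fun _ => stdW P α X i ω) (stdV P α X i ω),
    Set.indicator (setAV a b) (fun _ => stdW P α X i ω ^ 2 - 1) (stdV P α X i ω)]

/-- The matrix `Σ^A(k,l) = Cov[Z_{1,k}, Z_{1,l}] / (b-a)²`. -/
def limitCov (P : Measure Ω) (α : Fin 2 → ℝ) (X : ℕ → Ω → EuclideanSpace ℝ (Fin 2))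
    (a b : ℝ) : Matrix (Fin 5) (Fin 5) ℝ :=
  Matrix.of fun k l =>
    1 / (b - a) ^ 2 *
      covariance (fun ω => repZ P α X a b 0 ω k) (fun ω => repZ P α X a b 0 ω l) P

/-- The limit of the sample conditional mean as a linear combination of the coordinates
`(J₁, J₂, B₁, B₂, B₃)` of `z`; here `s` is the standard deviation and `g` the angle of the
coordinate. -/
def meanLimit (s g : ℝ) (z : EuclideanSpace ℝ (Fin 5)) : ℝ :=
  s * (Real.cos g * z 0 + Real.sin g * z 3)

/-- The limit of the sample conditional covariance as a linear combination of the coordinates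
`(J₁, J₂, B₁, B₂, B₃)` of `z`; here `l` is `λ_{A,1}`. -/
def covLimit (s g : Fin 2 → ℝ) (l : ℝ) (z : EuclideanSpace ℝ (Fin 5)) : ℝ :=
  s 0 * s 1 *
    (Real.cos (g 0) * Real.cos (g 1) * (z 1 - 2 * l * z 0)
      + Real.sin (g 0 + g 1) * (z 2 - l * z 3)
      + Real.sin (g 0) * Real.sin (g 1) * z 4)

end QuantileCov

end

/-! After standardisation the problem concerns independent standard normal pairs `(V, W)`. The
benchmark is an increasing affine function of `V`, so ranking by it is ranking by `V`, and
conditioning on its quantile set is conditioning on `V ∈ setAV a b`. Each coordinate of the sample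
is an affine image of a rotation of `(V, W)` (`exists_angle_representation`). The sample moments are
therefore polynomials in the ranked means of `V`, `V²`, `VW`, `W` and `W² - 1`.

The core is the replacement of the rank condition "among the `[np]` smallest" by the threshold
condition `V ≤ Φ⁻¹(p)`. A threshold indicator is itself a rank indicator, with a random rank
(`rankBelow_countLe`). The number of indices where the two conditions disagree is thus exactly
`|[np] - countLe q|`, where `q = Φ⁻¹(p)`, which is of order `√n` in mean square
(`sum_abs_rankBelow_sub`, `integral_sq_floor_sub_countLe`). Two mechanisms make the resulting error
`o(√n)` in probability. For a continuous function `f` of `V`, the disagreeing values lie near `q`,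
so `f(V) - f(q)` is small there, while the constant `f(q)` multiplies a centred count of values
below `q` and yields the boundary terms of `trimRep` (`nullSeq_rankDiff_self`). For `g(V) e(W)` with
`e(W)` centred, the sum is a martingale-like sum with coefficients depending on the `V`s only; its
terms are uncorrelated, and its second moment is of order `n^(3/4)` (`nullSeq_rankDiff_cross`). No
density estimate at the quantile is needed.

The five ranked means thus agree, up to null errors, with scaled sums of the i.i.d. centred vectors
`pairZ`, to which the multivariate central limit theorem applies. The covariance also contains
products of two deviations of means. Each deviation is null at scale `n^(-1/4)`, so `√n` times a
product is null, and only the linear part survives (`nullSeq_product`). Slutsky's theorem and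
continuous mapping finish the proof. -/

namespace QuantileCov

open scoped Topology

/-! ### Convergence to zero in probability -/

section NullSeq

variable {Ω : Type*} [MeasurableSpace Ω] {P : Measure Ω}

/-- Real random variables `f n` that converge to zero in probability. -/
def NullSeq (P : Measure Ω) (f : ℕ → Ω → ℝ) : Prop :=
  ∀ ε > 0, Tendsto (fun n => P.real {ω | ε ≤ |f n ω|}) atTop (𝓝 0)

lemma nullSeq_of_eventually_le {f : ℕ → Ω → ℝ}
    (h : ∀ ε > 0, ∀ δ > 0, ∀ᶠ n in atTop, P.real {ω | ε ≤ |f n ω|} ≤ δ) : NullSeq P f := by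
  intro ε hε
  refine Metric.tendsto_atTop'.2 fun δ hδ => ?_
  obtain ⟨N, hN⟩ := eventually_atTop.1 (h ε hε (δ / 2) (by positivity))
  refine ⟨N, fun n hn => ?_⟩
  rw [Real.dist_eq, sub_zero, abs_of_nonneg measureReal_nonneg]
  linarith [hN n hn.le]

variable {f g : ℕ → Ω → ℝ}

lemma NullSeq.congr' (hf : NullSeq P f) (h : ∀ᶠ n in atTop, f n =ᵐ[P] g n) : NullSeq P g := by
  intro ε hε
  refine (hf ε hε).congr' ?_
  filter_upwards [h] with n hn
  refine measureReal_congr ?_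
  filter_upwards [hn] with ω hω
  apply propext
  change ε ≤ |f n ω| ↔ ε ≤ |g n ω|
  rw [hω]

variable [IsFiniteMeasure P]

lemma NullSeq.mono (hf : NullSeq P f) (h : ∀ n ω, |g n ω| ≤ |f n ω|) : NullSeq P g := by
  intro ε hε
  exact squeeze_zero (fun _ => measureReal_nonneg)
    (fun n => measureReal_mono fun ω (hω : ε ≤ _) => hω.trans (h n ω)) (hf ε hε)

lemma NullSeq.add (hf : NullSeq P f) (hg : NullSeq P g) :
    NullSeq P (fun n ω => f n ω + g n ω) := by
  intro ε hε
  have h := (hf (ε / 2) (by positivity)).add (hg (ε / 2) (by positivity))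
  rw [add_zero] at h
  refine squeeze_zero (fun _ => measureReal_nonneg) (fun n => ?_) h
  refine (measureReal_mono (fun ω (hω : ε ≤ |f n ω + g n ω|) => ?_)).trans
    (measureReal_union_le _ _)
  by_contra hc
  simp only [Set.mem_union, Set.mem_ofPred_eq, not_or, not_le] at hc
  linarith [abs_add_le (f n ω) (g n ω)]

lemma NullSeq.neg (hf : NullSeq P f) : NullSeq P (fun n ω => -f n ω) :=
  hf.mono fun n ω => by simp

lemma NullSeq.sub (hf : NullSeq P f) (hg : NullSeq P g) :
    NullSeq P (fun n ω => f n ω - g n ω) := by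
  simpa only [sub_eq_add_neg] using hf.add hg.neg

/-- If the product is at least `ε` in absolute value, one of the factors is at least `√ε`. -/
lemma NullSeq.mul (hf : NullSeq P f) (hg : NullSeq P g) :
    NullSeq P (fun n ω => f n ω * g n ω) := by
  intro ε hε
  have h := (hf (√ε) (by positivity)).add (hg (√ε) (by positivity))
  rw [add_zero] at h
  refine squeeze_zero (fun _ => measureReal_nonneg) (fun n => ?_) h
  refine (measureReal_mono (fun ω (hω : ε ≤ |f n ω * g n ω|) => ?_)).trans
    (measureReal_union_le _ _)
  by_contra hc
  simp only [Set.mem_union, Set.mem_ofPred_eq, not_or, not_le] at hc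
  rw [abs_mul] at hω
  have := mul_lt_mul'' hc.1 hc.2 (abs_nonneg _) (abs_nonneg _)
  rw [Real.mul_self_sqrt hε.le] at this
  linarith

lemma NullSeq.mul_tendsto (hf : NullSeq P f) {c : ℕ → ℝ} {c₀ : ℝ} (hc : Tendsto c atTop (𝓝 c₀)) :
    NullSeq P (fun n ω => c n * f n ω) := by
  intro ε hε
  have hC : ∀ᶠ n in atTop, |c n| < |c₀| + 1 := hc.abs.eventually_lt_const (by linarith)
  have hpos : 0 < |c₀| + 1 := by positivity
  refine squeeze_zero' (Eventually.of_forall fun _ => measureReal_nonneg) ?_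
    (hf (ε / (|c₀| + 1)) (by positivity))
  filter_upwards [hC] with n hn
  refine measureReal_mono fun ω (hω : ε ≤ |c n * f n ω|) => ?_
  change ε / (|c₀| + 1) ≤ |f n ω|
  rw [div_le_iff₀ hpos]
  rw [abs_mul] at hω
  nlinarith [abs_nonneg (f n ω)]

lemma NullSeq.const_mul (hf : NullSeq P f) (c : ℝ) : NullSeq P (fun n ω => c * f n ω) :=
  hf.mul_tendsto tendsto_const_nhds

/-- Chebyshev's inequality. -/
lemma nullSeq_of_tendsto_integral_sq (hi : ∀ n, Integrable (fun ω => f n ω ^ 2) P)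
    (h : Tendsto (fun n => ∫ ω, f n ω ^ 2 ∂P) atTop (𝓝 0)) : NullSeq P f := by
  intro ε hε
  have h' := h.const_mul (ε ^ 2)⁻¹
  rw [mul_zero] at h'
  refine squeeze_zero (fun _ => measureReal_nonneg) (fun n => ?_) h'
  have := mul_meas_ge_le_integral_of_nonneg (ae_of_all P fun ω => sq_nonneg (f n ω)) (hi n) (ε ^ 2)
  rw [inv_mul_eq_div, le_div_iff₀ (by positivity), mul_comm]
  refine le_trans (mul_le_mul_of_nonneg_left (measureReal_mono fun ω (hω : ε ≤ |f n ω|) => ?_)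
    (by positivity)) this
  change ε ^ 2 ≤ f n ω ^ 2
  rw [← sq_abs (f n ω)]
  gcongr

lemma nullSeq_of_tendsto {c : ℕ → ℝ} (hc : Tendsto c atTop (𝓝 0)) :
    NullSeq P (fun n _ => c n) := by
  refine nullSeq_of_tendsto_integral_sq (fun n => integrable_const _) ?_
  simpa using (hc.pow 2).const_mul (P.real Set.univ)

lemma NullSeq.tendstoInMeasure (hf : NullSeq P f) : TendstoInMeasure P f atTop 0 := by
  rw [tendstoInMeasure_iff_measureReal_norm]
  simpa [NullSeq] using hf

end NullSeq

/-! ### Sums of independent identically distributed variables -/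

section IID

variable {Ω : Type*} [MeasurableSpace Ω] {P : Measure Ω} [IsProbabilityMeasure P]

lemma integral_sq_sum_iid {ξ : ℕ → Ω → ℝ} (hind : iIndepFun ξ P)
    (hid : ∀ i, IdentDistrib (ξ i) (ξ 0) P P) (hL : MemLp (ξ 0) 2 P) (h0 : ∫ ω, ξ 0 ω ∂P = 0)
    (n : ℕ) :
    Integrable (fun ω => (∑ i ∈ Finset.range n, ξ i ω) ^ 2) P ∧
    ∫ ω, (∑ i ∈ Finset.range n, ξ i ω) ^ 2 ∂P = n * ∫ ω, ξ 0 ω ^ 2 ∂P := by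
  have hLi (i : ℕ) : MemLp (ξ i) 2 P := (hid i).memLp_iff.2 hL
  have h0i (i : ℕ) : ∫ ω, ξ i ω ∂P = 0 := (hid i).integral_eq.trans h0
  have hS : MemLp (fun ω => ∑ i ∈ Finset.range n, ξ i ω) 2 P :=
    memLp_finsetSum _ fun i _ => hLi i
  refine ⟨hS.integrable_sq, ?_⟩
  have hv := IndepFun.variance_sum (μ := P) (X := ξ) (s := Finset.range n) (fun i _ => hLi i)
    (fun i _ j _ hij => hind.indepFun hij)
  have hm : ∫ ω, (∑ i ∈ Finset.range n, ξ i) ω ∂P = 0 := by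
    simp_rw [Finset.sum_apply]
    rw [integral_finsetSum _ fun i _ => (hLi i).integrable (by norm_num)]
    simp [h0i]
  rw [variance_of_integral_eq_zero (by simpa [Finset.sum_fn] using hS.aemeasurable) hm] at hv
  simp_rw [Finset.sum_apply] at hv
  rw [hv, Finset.sum_congr rfl fun i _ => (hid i).variance_eq]
  rw [variance_of_integral_eq_zero hL.aemeasurable h0]
  simp

/-- The second moment is `c n ^ 2 * n` times a constant. With `c n = 1 / n` this is the weak law of
large numbers; it also serves at the scale `n^(-3/4)`. -/
lemma nullSeq_rpow_mul_sum_iid {ξ : ℕ → Ω → ℝ} (hind : iIndepFun ξ P)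
    (hid : ∀ i, IdentDistrib (ξ i) (ξ 0) P P) (hL : MemLp (ξ 0) 2 P) (h0 : ∫ ω, ξ 0 ω ∂P = 0)
    {c : ℕ → ℝ} (hc : Tendsto (fun n => c n ^ 2 * n) atTop (𝓝 0)) :
    NullSeq P (fun n ω => c n * ∑ i ∈ Finset.range n, ξ i ω) := by
  have h := integral_sq_sum_iid hind hid hL h0
  refine nullSeq_of_tendsto_integral_sq (fun n => ?_) ?_
  · simp_rw [mul_pow]
    exact (h n).1.const_mul _
  · simp_rw [mul_pow, integral_const_mul, fun n => (h n).2, ← mul_assoc]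
    simpa using hc.mul_const (∫ ω, ξ 0 ω ^ 2 ∂P)

end IID

/-! ### The multivariate central limit theorem -/

section CLT

variable {Ω : Type*} [MeasurableSpace Ω] {P : Measure Ω} [IsProbabilityMeasure P]
  {E : Type*} [NormedAddCommGroup E] [InnerProductSpace ℝ E] [FiniteDimensional ℝ E]
  [MeasurableSpace E] [BorelSpace E]

open scoped RealInnerProductSpace

lemma charFun_map_inner {Ω : Type*} [MeasurableSpace Ω] {P : Measure Ω} {X : Ω → E}
    (hX : AEMeasurable X P) (t : E) :
    charFun (P.map fun ω => ⟪t, X ω⟫) 1 = charFun (P.map X) t := by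
  rw [charFun_apply, charFun_apply, integral_map (by fun_prop) (by fun_prop),
    integral_map (by fun_prop) (by fun_prop)]
  simp [real_inner_comm]

/-- The **Cramér–Wold device**. -/
lemma tendstoInDistribution_of_inner {Ω' : Type*} [MeasurableSpace Ω'] {Q : Measure Ω'}
    [IsProbabilityMeasure Q] {T : ℕ → Ω → E} {L : Ω' → E} (hT : ∀ n, AEMeasurable (T n) P)
    (hL : AEMeasurable L Q)
    (h : ∀ t : E, TendstoInDistribution (fun n ω => ⟪t, T n ω⟫) atTop (fun ω' => ⟪t, L ω'⟫)
      (fun _ => P) Q) :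
    TendstoInDistribution T atTop L (fun _ => P) Q where
  forall_aemeasurable := hT
  aemeasurable_limit := hL
  tendsto := by
    -- Lévy's continuity theorem, used in both directions: the characteristic function of the vector
    -- at `t` is that of the scalar `⟪t, ·⟫` at `1`.
    refine ProbabilityMeasure.tendsto_iff_tendsto_charFun.2 fun t => ?_
    have := ProbabilityMeasure.tendsto_iff_tendsto_charFun.1 (h t).tendsto 1
    simp only [ProbabilityMeasure.coe_mk] at this ⊢
    simpa only [charFun_map_inner hL, fun n => charFun_map_inner (hT n)] using this

/-- The **central limit theorem** in finite dimension, for a limit that is given up to a scalar. -/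
theorem tendstoInDistribution_smul_sum_iid {Ω' : Type*} [MeasurableSpace Ω'] {Q : Measure Ω'}
    [IsProbabilityMeasure Q] {ξ : ℕ → Ω → E} {L : Ω' → E} (hind : iIndepFun ξ P)
    (hid : ∀ i, IdentDistrib (ξ i) (ξ 0) P P) (hmeas : ∀ i, Measurable (ξ i))
    (hL2 : MemLp (ξ 0) 2 P) (h0 : ∫ ω, ξ 0 ω ∂P = 0)
    {c : ℝ} (hc : c ≠ 0) {d : ℕ → ℝ} (hd : Tendsto (fun n => d n * √n) atTop (𝓝 c))
    (hL : AEMeasurable L Q)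
    (hlaw : ∀ t : E, HasLaw (fun ω' => ⟪t, L ω'⟫)
      (gaussianReal 0 (c ^ 2 * Var[fun ω => ⟪t, ξ 0 ω⟫; P]).toNNReal) Q) :
    TendstoInDistribution (fun n ω => d n • ∑ i ∈ Finset.range n, ξ i ω) atTop L
      (fun _ => P) Q := by
  have key : TendstoInDistribution (fun (n : ℕ) ω => (√n)⁻¹ • ∑ i ∈ Finset.range n, ξ i ω) atTop
      (fun ω' => c⁻¹ • L ω') (fun _ => P) Q := by
    refine tendstoInDistribution_of_inner (fun n => ?_) (by fun_prop) fun t => ?_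
    · exact (Finset.measurable_sum _ fun i _ => hmeas i).aemeasurable.const_smul _
    have hY : HasLaw (fun ω' => ⟪t, c⁻¹ • L ω'⟫)
        (gaussianReal 0 (Var[fun ω => ⟪t, ξ 0 ω⟫; P]).toNNReal) Q := by
      have h := hlaw (c⁻¹ • t)
      simp_rw [inner_smul_left, conj_trivial] at h
      simp_rw [inner_smul_right]
      convert h using 3
      rw [variance_const_mul]
      field_simp
    have hm (i : ℕ) : Measurable fun ω => ⟪t, ξ i ω⟫ := by
      have := hmeas i
      fun_prop
    have hclt := tendstoInDistribution_inv_sqrt_mul_sum_sub (P := P)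
      (X := fun i ω => ⟪t, ξ i ω⟫) hY (hL2.const_inner t)
      (hind.comp (fun _ x => ⟪t, x⟫) fun _ => by fun_prop)
      (fun i => (hid i).comp (u := fun x => ⟪t, x⟫) (by fun_prop))
    have hz : ∫ ω, ⟪t, ξ 0 ω⟫ ∂P = 0 := by
      rw [integral_inner (hL2.integrable (by norm_num)), h0, inner_zero_right]
    convert hclt using 3 with n ω
    rw [hz, mul_zero, sub_zero, inner_smul_right, inner_sum]
  -- Slutsky: the normalisation `d n` is `(√n)⁻¹` times the deterministic factor `d n * √n → c`,
  -- which restores `L` from `c⁻¹ • L`.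
  have h2 := key.continuous_comp_prodMk_of_tendstoInMeasure_const
    (Y := fun (n : ℕ) (_ : Ω) => d n * √n) (c := c) (g := fun p : E × ℝ => p.2 • p.1)
    (by fun_prop) ?_ (fun n => by fun_prop)
  · have hx : (fun ω' => c • c⁻¹ • L ω') = L := by
      ext1 ω'
      rw [smul_smul, mul_inv_cancel₀ hc, one_smul]
    simp only [hx] at h2
    refine h2.congr (fun n => ae_of_all _ fun ω => ?_) EventuallyEq.rfl
    rcases Nat.eq_zero_or_pos n with rfl | hn
    · simp
    have : √(n : ℝ) ≠ 0 := by positivity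
    simp only
    rw [smul_smul, mul_assoc, mul_inv_cancel₀ this, mul_one]
  · refine tendstoInMeasure_of_tendsto_ae (fun n => by fun_prop) (ae_of_all _ fun ω => hd)

end CLT

open scoped Topology

/-! ### Quantiles of the standard normal law -/

section Quantile

/-- The jump of the distribution function at a point is the mass of that point, and the normal law
has no atoms. -/
lemma continuous_cdf_gaussianReal : Continuous (cdf (gaussianReal 0 1)) := by
  have := nullSingletonClass_gaussianReal (μ := 0) (v := 1) one_ne_zero
  refine continuous_iff_continuousAt.2 fun x => ?_
  rw [(monotone_cdf _).continuousAt_iff_leftLim_eq_rightLim]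
  have h1 : (cdf (gaussianReal 0 1)).measure {x} = 0 := by
    rw [measure_cdf]
    exact measure_singleton x
  rw [StieltjesFunction.measure_singleton, ENNReal.ofReal_eq_zero] at h1
  rw [(cdf (gaussianReal 0 1)).rightLim_eq]
  exact le_antisymm ((monotone_cdf _).leftLim_le le_rfl) (by linarith)

/-- Lebesgue measure is absolutely continuous with respect to the normal law, so no nondegenerate
interval is null. -/
lemma strictMono_cdf_gaussianReal : StrictMono (cdf (gaussianReal 0 1)) := by
  intro x y hxy
  have h1 : gaussianReal 0 1 (Set.Ioc x y) ≠ 0 := by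
    intro h
    have := gaussianReal_absolutelyContinuous' 0 one_ne_zero h
    simp only [Real.volume_Ioc, ENNReal.ofReal_eq_zero] at this
    linarith
  rw [← measure_cdf (gaussianReal 0 1), StieltjesFunction.measure_Ioc] at h1
  by_contra hc
  exact h1 (ENNReal.ofReal_eq_zero.2 (by linarith))

lemma cdf_gaussianReal_lt_one (x : ℝ) : cdf (gaussianReal 0 1) x < 1 :=
  (strictMono_cdf_gaussianReal (lt_add_one x)).trans_le (cdf_le_one _ _)

lemma PhiInv_zero : PhiInv 0 = ⊥ := by
  rw [PhiInv, quantile, EReal.eq_bot_iff_forall_lt]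
  intro y
  refine (sInf_le (a := ((y - 1 : ℝ) : EReal)) ?_).trans_lt ?_
  · exact ⟨y - 1, cdf_nonneg _ _, rfl⟩
  · exact EReal.coe_lt_coe_iff.2 (by linarith)

lemma PhiInv_one : PhiInv 1 = ⊤ := by
  rw [PhiInv, quantile]
  have : {x : ℝ | 1 ≤ cdf (gaussianReal 0 1) x} = ∅ :=
    Set.eq_empty_of_forall_notMem fun x hx => absurd hx (not_le.2 (cdf_gaussianReal_lt_one x))
  rw [this, Set.image_empty, sInf_empty]

/-- The intermediate value theorem gives `q`; strict monotonicity then turns the set in the infimum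
into `[q, ∞)`. -/
lemma exists_PhiInv_eq {p : ℝ} (h0 : 0 < p) (h1 : p < 1) :
    ∃ q : ℝ, PhiInv p = q ∧ cdf (gaussianReal 0 1) q = p := by
  have hq : p ∈ Set.range (cdf (gaussianReal 0 1)) := by
    refine mem_range_of_exists_le_of_exists_ge continuous_cdf_gaussianReal ?_ ?_
    · exact ((tendsto_cdf_atBot (gaussianReal 0 1)).eventually_le_const h0).exists
    · exact ((tendsto_cdf_atTop (gaussianReal 0 1)).eventually_const_le h1).exists
  obtain ⟨q, rfl⟩ := hq
  refine ⟨q, ?_, rfl⟩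
  rw [PhiInv, quantile]
  simp only [strictMono_cdf_gaussianReal.le_iff_le]
  refine le_antisymm (sInf_le ⟨q, Set.mem_ofPred.2 le_rfl, rfl⟩) (le_sInf ?_)
  rintro _ ⟨x, hx, rfl⟩
  exact EReal.coe_le_coe_iff.2 hx

lemma indLe_zero (v : ℝ) : indLe 0 v = 0 := by
  simp [indLe, PhiInv_zero, Set.indicator]

lemma indLe_one (v : ℝ) : indLe 1 v = 1 := by
  simp [indLe, PhiInv_one, Set.indicator]

lemma indLe_eq_indicator_Iic {p q : ℝ} (h : PhiInv p = q) : indLe p = (Set.Iic q).indicator 1 := by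
  unfold indLe
  simp_rw [h, EReal.coe_le_coe_iff]
  rfl

lemma indLe_eq_zero_or_one (p v : ℝ) : indLe p v = 0 ∨ indLe p v = 1 := by
  unfold indLe
  by_cases h : v ∈ {v : ℝ | (v : EReal) ≤ PhiInv p}
  · exact Or.inr (by rw [Set.indicator_of_mem h]; rfl)
  · exact Or.inl (Set.indicator_of_notMem h _)

lemma measurable_indLe (p : ℝ) : Measurable (indLe p) :=
  measurable_one.indicator (measurableSet_le measurable_coe_real_ereal measurable_const)

lemma measurableSet_setAV (a b : ℝ) : MeasurableSet (setAV a b) :=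
  (measurableSet_lt measurable_const measurable_coe_real_ereal).inter
    (measurableSet_lt measurable_coe_real_ereal measurable_const)

lemma integral_indLe {p : ℝ} (h0 : 0 ≤ p) (h1 : p ≤ 1) :
    ∫ v, indLe p v ∂(gaussianReal 0 1) = p := by
  rcases h0.eq_or_lt with rfl | h0
  · simp [indLe_zero]
  rcases h1.eq_or_lt with rfl | h1
  · simp [indLe_one]
  obtain ⟨q, hq, hc⟩ := exists_PhiInv_eq h0 h1
  rw [indLe_eq_indicator_Iic hq, integral_indicator_one measurableSet_Iic, ← cdf_eq_real, hc]

lemma PhiInv_mono {a b : ℝ} (hab : a ≤ b) : PhiInv a ≤ PhiInv b :=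
  sInf_le_sInf (Set.image_mono fun _ hx => hab.trans hx)

/-- The two sides can differ only at `v = Φ⁻¹(b)`, which `indLe b` includes and `setAV a b`
excludes. The null set is chosen before `f`, so it serves all functions at once. -/
lemma indicator_setAV_ae {a b : ℝ} (ha : 0 ≤ a) (hab : a < b) (hb : b ≤ 1) :
    ∀ᵐ v ∂(gaussianReal 0 1), ∀ f : ℝ → ℝ,
      (setAV a b).indicator f v = (indLe b v - indLe a v) * f v := by
  have := nullSingletonClass_gaussianReal (μ := 0) (v := 1) one_ne_zero
  have hne : ∀ᵐ v : ℝ ∂(gaussianReal 0 1), (v : EReal) ≠ PhiInv b := by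
    rcases hb.eq_or_lt with rfl | hb
    · simp [PhiInv_one]
    obtain ⟨q, hq, -⟩ := exists_PhiInv_eq (ha.trans_lt hab) hb
    rw [hq]
    filter_upwards [measure_eq_zero_iff_ae_notMem.1 (measure_singleton q)] with v hv
    simpa using hv
  filter_upwards [hne] with v hv f
  have hm := PhiInv_mono hab.le
  by_cases h1 : (v : EReal) ≤ PhiInv a
  · have h2 : v ∉ setAV a b := fun h => absurd h1 (not_le.2 h.1)
    have h3 := h1.trans hm
    rw [Set.indicator_of_notMem h2]
    simp [indLe, Set.indicator, h1, h3]
  by_cases h3 : (v : EReal) ≤ PhiInv b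
  · have h2 : v ∈ setAV a b := ⟨not_le.1 h1, lt_of_le_of_ne h3 hv⟩
    rw [Set.indicator_of_mem h2]
    simp [indLe, Set.indicator, h1, h3]
  · have h2 : v ∉ setAV a b := fun h => h3 h.2.le
    rw [Set.indicator_of_notMem h2]
    simp [indLe, Set.indicator, h1, h3]

lemma integrable_indLe (p : ℝ) : Integrable (indLe p) (gaussianReal 0 1) := by
  refine Integrable.of_bound (measurable_indLe p).aestronglyMeasurable 1 (ae_of_all _ fun v => ?_)
  rcases indLe_eq_zero_or_one p v with h | h <;> simp [h]

lemma gaussianReal_real_setAV {a b : ℝ} (ha : 0 ≤ a) (hab : a < b) (hb : b ≤ 1) :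
    (gaussianReal 0 1).real (setAV a b) = b - a := by
  rw [← integral_indicator_one (measurableSet_setAV a b)]
  have : (setAV a b).indicator 1 =ᵐ[gaussianReal 0 1] fun v => indLe b v - indLe a v := by
    filter_upwards [indicator_setAV_ae ha hab hb] with v hv
    simpa using hv 1
  rw [integral_congr_ae this, integral_sub (integrable_indLe b) (integrable_indLe a),
    integral_indLe (ha.trans hab.le) hb, integral_indLe ha (hab.le.trans hb)]

/-- A description free of extended reals, suited to a change of variables. The intermediate point
`z` encodes strict inequality below an infimum, and the last condition is vacuous when the upper
quantile is `+∞`. -/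
lemma mem_quantileSet_iff {ν : Measure ℝ} {a b y : ℝ} :
    y ∈ quantileSet ν a b ↔
      (∃ x, a ≤ cdf ν x ∧ x < y) ∧ ∃ z, y < z ∧ ∀ x, b ≤ cdf ν x → z ≤ x := by
  refine and_congr ?_ ?_
  · rw [quantile, sInf_lt_iff]
    simp
  · constructor
    · intro h
      obtain ⟨z, hz1, hz2⟩ := EReal.lt_iff_exists_real_btwn.1 h
      refine ⟨z, EReal.coe_lt_coe_iff.1 hz1, fun x hx => ?_⟩
      exact EReal.coe_le_coe_iff.1 (hz2.le.trans (sInf_le ⟨x, hx, rfl⟩))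
    · rintro ⟨z, hz1, hz2⟩
      refine (EReal.coe_lt_coe_iff.2 hz1).trans_le (le_sInf ?_)
      rintro _ ⟨x, hx, rfl⟩
      exact EReal.coe_le_coe_iff.2 (hz2 x hx)

lemma mem_quantileSet_map_affine {ν : Measure ℝ} [IsProbabilityMeasure ν] {m s : ℝ} (hs : 0 < s)
    (a b v : ℝ) :
    m + s * v ∈ quantileSet (ν.map fun v => m + s * v) a b ↔ v ∈ quantileSet ν a b := by
  have hp : IsProbabilityMeasure (ν.map fun v => m + s * v) :=
    Measure.isProbabilityMeasure_map (by fun_prop)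
  have hc (x : ℝ) : cdf (ν.map fun v => m + s * v) (m + s * x) = cdf ν x := by
    rw [cdf_eq_real, cdf_eq_real, map_measureReal_apply (by fun_prop) measurableSet_Iic]
    congr 1
    ext y
    simp [hs]
  have hsurj : Function.Surjective fun x : ℝ => m + s * x := fun y =>
    ⟨(y - m) / s, by field_simp; ring⟩
  have hf (z : ℝ) : (∀ x, b ≤ cdf (ν.map fun v => m + s * v) x → m + s * z ≤ x) ↔
      ∀ x, b ≤ cdf ν x → z ≤ x := by
    rw [hsurj.forall]
    simp only [hc, add_le_add_iff_left, mul_le_mul_iff_right₀ hs]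
  rw [mem_quantileSet_iff, mem_quantileSet_iff]
  refine and_congr (hsurj.exists.trans (exists_congr fun x => ?_))
    (hsurj.exists.trans (exists_congr fun z => ?_))
  · simp only [hc, add_lt_add_iff_left, mul_lt_mul_iff_right₀ hs]
  · simp only [hf, add_lt_add_iff_left, mul_lt_mul_iff_right₀ hs]

end Quantile

/-! ### Ranks -/

section Rank

variable {n : ℕ}

/-- The indicator of the event that `y i` is among the `k` smallest of the values `y`. -/
noncomputable def rankBelow (k : ℕ) (y : Fin n → ℝ) (i : Fin n) : ℝ :=
  if ((Tuple.sort y).symm i).val < k then 1 else 0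

/-- The number of values that are at most `x`. -/
noncomputable def countLe (x : ℝ) (y : Fin n → ℝ) : ℕ := (Finset.univ.filter fun i => y i ≤ x).card

lemma countLe_le (x : ℝ) (y : Fin n → ℝ) : countLe x y ≤ n :=
  (Finset.card_le_univ _).trans_eq (Fintype.card_fin n)

lemma countLe_eq_sum (x : ℝ) (y : Fin n → ℝ) :
    (countLe x y : ℝ) = ∑ i, (Set.Iic x).indicator (1 : ℝ → ℝ) (y i) := by
  rw [countLe, Finset.card_filter]
  push_cast
  rfl

/-- In the sorted sequence the values at most `x` fill exactly the first `countLe x y` positions.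
Ranks start at `0`, hence the strict inequality; ties do no harm. -/
lemma rank_lt_countLe_iff (x : ℝ) (y : Fin n → ℝ) (i : Fin n) :
    ((Tuple.sort y).symm i).val < countLe x y ↔ y i ≤ x := by
  have h := Tuple.lt_card_le_iff_apply_le_of_monotone (j := (Tuple.sort y).symm i) (a := x)
    (Tuple.monotone_sort y)
  simp only [Function.comp_apply, Equiv.apply_symm_apply] at h
  rw [← h, countLe]
  have hc : (Finset.univ.filter fun i => y (Tuple.sort y i) ≤ x).card
      = (Finset.univ.filter fun i => y i ≤ x).card :=
    Finset.card_bij (fun j _ => Tuple.sort y j) (by simp)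
      (fun _ _ _ _ hij => (Tuple.sort y).injective hij)
      (fun j hj => ⟨(Tuple.sort y).symm j, by simpa using hj, by simp⟩)
  rw [hc]

/-- This makes rank and threshold conditions comparable: their difference becomes a difference of
two rank indicators. -/
lemma rankBelow_countLe (x : ℝ) (y : Fin n → ℝ) (i : Fin n) :
    rankBelow (countLe x y) y i = (Set.Iic x).indicator 1 (y i) := by
  simp only [rankBelow, rank_lt_countLe_iff, Set.indicator, Set.mem_Iic, Pi.one_apply]

lemma sum_rankBelow_mul (k : ℕ) (y z : Fin n → ℝ) :
    ∑ i, rankBelow k y i * z i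
      = ∑ j ∈ Finset.univ.filter (fun j : Fin n => j.val < k), z (Tuple.sort y j) := by
  rw [← Equiv.sum_comp (Tuple.sort y), Finset.sum_filter]
  simp [rankBelow]

lemma sum_rankBelow {k : ℕ} (hk : k ≤ n) (y : Fin n → ℝ) : ∑ i, rankBelow k y i = k := by
  have h := sum_rankBelow_mul k y 1
  simp only [Pi.one_apply, mul_one, Finset.sum_const, nsmul_eq_mul] at h
  rw [h, Fin.card_filter_val_lt, min_eq_right hk]

lemma rankBelow_mono {k l : ℕ} (h : k ≤ l) (y : Fin n → ℝ) (i : Fin n) :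
    rankBelow k y i ≤ rankBelow l y i := by
  unfold rankBelow
  split_ifs with h1 h2 <;> first | omega | norm_num

lemma rankBelow_eq_zero_or_one (k : ℕ) (y : Fin n → ℝ) (i : Fin n) :
    rankBelow k y i = 0 ∨ rankBelow k y i = 1 := by
  unfold rankBelow
  split_ifs <;> simp

/-- Rank indicators increase with the rank, so all the differences have the same sign and the
absolute values come out of the sum. -/
lemma sum_abs_rankBelow_sub {k l : ℕ} (hk : k ≤ n) (hl : l ≤ n) (y : Fin n → ℝ) :
    ∑ i, |rankBelow k y i - rankBelow l y i| = |(k : ℝ) - l| := by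
  wlog h : l ≤ k generalizing k l
  · simp_rw [abs_sub_comm (rankBelow k y _), abs_sub_comm (k : ℝ)]
    exact this hl hk (by omega)
  rw [abs_of_nonneg (by simpa using h), ← sum_rankBelow hk y, ← sum_rankBelow hl y,
    ← Finset.sum_sub_distrib]
  exact Finset.sum_congr rfl fun i _ => abs_of_nonneg (sub_nonneg.2 (rankBelow_mono h y i))

/-- The two count bounds trap the `k`-th rank between the thresholds `q - ε` and `q + ε`, so only
values between these thresholds can be classified differently by `k` and by `q`. -/
lemma abs_sub_le_of_rankBelow_ne {k : ℕ} {q ε : ℝ} {y : Fin n → ℝ} {i : Fin n}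
    (h : rankBelow k y i ≠ (Set.Iic q).indicator 1 (y i))
    (h1 : countLe (q - ε) y ≤ k) (h2 : k ≤ countLe (q + ε) y) : |y i - q| ≤ ε := by
  have e0 := rank_lt_countLe_iff q y i
  have e1 := rank_lt_countLe_iff (q - ε) y i
  have e2 := rank_lt_countLe_iff (q + ε) y i
  rw [← rankBelow_countLe] at h
  unfold rankBelow at h
  rw [abs_le]
  by_cases hk : ((Tuple.sort y).symm i).val < k
  · have hq : ¬ ((Tuple.sort y).symm i).val < countLe q y := fun hc => by simp [hk, hc] at h
    have a1 := not_le.1 (fun hc => hq (e0.2 hc))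
    have a2 := e2.1 (hk.trans_le h2)
    constructor <;> linarith
  · have hq : ((Tuple.sort y).symm i).val < countLe q y := by
      by_contra hc
      simp [hk, hc] at h
    have a1 := e0.1 hq
    have a2 : ¬ y i ≤ q - ε := fun hc => hk ((e1.2 hc).trans_le h1)
    constructor <;> linarith

lemma rankedMean_eq {a b : ℝ} (hab : a ≤ b) (y z : Fin n → ℝ) :
    rankedMean a b y z = (1 / (subsampleSize a b n : ℝ)) *
      ∑ i, (rankBelow ⌊(n : ℝ) * b⌋₊ y i - rankBelow ⌊(n : ℝ) * a⌋₊ y i) * z i := by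
  have hle : ⌊(n : ℝ) * a⌋₊ ≤ ⌊(n : ℝ) * b⌋₊ := Nat.floor_mono (by gcongr)
  rw [rankedMean]
  congr 1
  simp_rw [sub_mul]
  rw [Finset.sum_sub_distrib, sum_rankBelow_mul, sum_rankBelow_mul, eq_sub_iff_add_eq]
  rw [Finset.sum_filter, Finset.sum_filter, Finset.sum_filter, ← Finset.sum_add_distrib]
  refine Finset.sum_congr rfl fun j _ => ?_
  by_cases h1 : j.val < ⌊(n : ℝ) * a⌋₊
  · simp [h1, h1.trans_le hle]
  · simp [h1, not_lt.1 h1]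

/-- The sorting permutation is determined by the order and by breaking ties by index; an increasing
injective map preserves both. -/
lemma sort_affine {m s : ℝ} (hs : 0 < s) (y : Fin n → ℝ) :
    Tuple.sort (fun i => m + s * y i) = Tuple.sort y := by
  symm
  rw [Tuple.eq_sort_iff]
  have h := (Tuple.eq_sort_iff (f := y)).1 rfl
  refine ⟨fun i j hij => ?_, fun i j hij he => h.2 i j hij ?_⟩
  · have := h.1 hij
    simp only [Function.comp_apply] at this ⊢
    gcongr
  · simpa [hs.ne'] using he

lemma rankedMean_affine {m s : ℝ} (hs : 0 < s) (a b : ℝ) (y z : Fin n → ℝ) :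
    rankedMean a b (fun i => m + s * y i) z = rankedMean a b y z := by
  simp only [rankedMean, sort_affine hs]

lemma measurableSet_sort_eq (τ : Equiv.Perm (Fin n)) :
    MeasurableSet {y : Fin n → ℝ | τ = Tuple.sort y} := by
  simp only [Tuple.eq_sort_iff, Monotone, Function.comp_apply, Set.ofPred_and, Set.ofPred_forall]
  refine MeasurableSet.inter (.iInter fun i => .iInter fun j => .iInter fun _ => ?_)
    (.iInter fun i => .iInter fun j => .iInter fun _ => ?_)
  · exact measurableSet_le (by fun_prop) (by fun_prop)
  · by_cases h : τ i < τ j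
    · simp [h]
    · have := (measurableSet_eq_fun (measurable_pi_apply (X := fun _ : Fin n => ℝ) (τ i))
        (measurable_pi_apply (τ j))).compl
      simp only [h, imp_false]
      exact this

/-- The preimage of any set is a finite union of the measurable cells on which the sorting
permutation is constant. -/
lemma measurable_comp_sort {β : Type*} [MeasurableSpace β] (g : Equiv.Perm (Fin n) → β) :
    Measurable fun y : Fin n → ℝ => g (Tuple.sort y) := by
  intro s _
  have : (fun y : Fin n → ℝ => g (Tuple.sort y)) ⁻¹' s
      = ⋃ τ ∈ {τ | g τ ∈ s}, {y : Fin n → ℝ | τ = Tuple.sort y} := by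
    ext y
    simp
  rw [this]
  exact MeasurableSet.biUnion (Set.to_countable _) fun τ _ => measurableSet_sort_eq τ

lemma measurable_rankBelow (k : ℕ) (i : Fin n) :
    Measurable fun y : Fin n → ℝ => rankBelow k y i :=
  measurable_comp_sort fun τ => if (τ.symm i).val < k then (1 : ℝ) else 0

lemma measurable_rankedMean {Ω : Type*} [MeasurableSpace Ω] {a b : ℝ} (hab : a ≤ b)
    {y z : Ω → Fin n → ℝ} (hy : Measurable y) (hz : Measurable z) :
    Measurable fun ω => rankedMean a b (y ω) (z ω) := by
  simp_rw [rankedMean_eq hab]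
  refine (Finset.measurable_sum _ fun i _ => ?_).const_mul _
  exact (((measurable_rankBelow _ i).comp hy).sub ((measurable_rankBelow _ i).comp hy)).mul
    ((measurable_pi_apply i).comp hz)

lemma rankedMean_add (a b : ℝ) (y z w : Fin n → ℝ) :
    rankedMean a b y (fun i => z i + w i) = rankedMean a b y z + rankedMean a b y w := by
  simp only [rankedMean, Finset.sum_add_distrib, mul_add]

lemma rankedMean_const_mul (a b c : ℝ) (y z : Fin n → ℝ) :
    rankedMean a b y (fun i => c * z i) = c * rankedMean a b y z := by
  simp only [rankedMean, ← Finset.mul_sum]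
  ring

lemma rankedMean_const {a b : ℝ} (hab : a ≤ b) (hb : b ≤ 1)
    (hn : subsampleSize a b n ≠ 0) (y : Fin n → ℝ) (c : ℝ) :
    rankedMean a b y (fun _ => c) = c := by
  have hle {p : ℝ} (hp : p ≤ 1) : ⌊(n : ℝ) * p⌋₊ ≤ n := by
    refine Nat.floor_le_of_le ?_
    nlinarith [(Nat.cast_nonneg n : (0 : ℝ) ≤ n)]
  have hm : ⌊(n : ℝ) * a⌋₊ ≤ ⌊(n : ℝ) * b⌋₊ := Nat.floor_mono (by gcongr)
  rw [rankedMean_eq hab, ← Finset.sum_mul, Finset.sum_sub_distrib, sum_rankBelow (hle hb),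
    sum_rankBelow (hle (hab.trans hb)), ← Nat.cast_sub hm, ← subsampleSize]
  field_simp

end Rank

open scoped Topology

/-! ### Independent pairs of independent standard normal variables -/

/-- `V i, W i`, `i : ℕ`, are independent standard normal variables. -/
structure StdPairs {Ω : Type*} [MeasurableSpace Ω] (P : Measure Ω) (V W : ℕ → Ω → ℝ) : Prop where
  mpV : ∀ i, MeasurePreserving (V i) P (gaussianReal 0 1)
  mpW : ∀ i, MeasurePreserving (W i) P (gaussianReal 0 1)
  indep : iIndepFun (fun i ω => (V i ω, W i ω)) P
  indepVW : ∀ i, V i ⟂ᵢ[P] W i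

lemma countLe_sub_eq {Ω : Type*} {V : ℕ → Ω → ℝ} (x : ℝ) (n : ℕ) (ω : Ω) :
    (countLe x fun k : Fin n => V k ω) - n * cdf (gaussianReal 0 1) x
      = ∑ i ∈ Finset.range n,
        ((Set.Iic x).indicator (1 : ℝ → ℝ) (V i ω) - cdf (gaussianReal 0 1) x) := by
  rw [countLe_eq_sum, Fin.sum_univ_eq_sum_range
    (fun i => (Set.Iic x).indicator (1 : ℝ → ℝ) (V i ω)) n]
  simp

section Pairs

variable {Ω : Type*} [MeasurableSpace Ω] {P : Measure Ω} {V W : ℕ → Ω → ℝ}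

namespace StdPairs

variable (h : StdPairs P V W)
include h

lemma measV (i : ℕ) : Measurable (V i) := (h.mpV i).measurable

lemma measW (i : ℕ) : Measurable (W i) := (h.mpW i).measurable

lemma measVs (n : ℕ) : Measurable fun ω (k : Fin n) => V k ω :=
  measurable_pi_iff.2 fun k => h.measV k

lemma integral_comp_V (i : ℕ) {f : ℝ → ℝ} (hf : Measurable f) :
    ∫ ω, f (V i ω) ∂P = ∫ v, f v ∂(gaussianReal 0 1) :=
  (h.mpV i).hasLaw.integral_comp hf.aestronglyMeasurable

lemma integral_comp_W (i : ℕ) {f : ℝ → ℝ} (hf : Measurable f) :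
    ∫ ω, f (W i ω) ∂P = ∫ v, f v ∂(gaussianReal 0 1) :=
  (h.mpW i).hasLaw.integral_comp hf.aestronglyMeasurable

lemma iIndepFun_comp {β : Type*} [MeasurableSpace β] {g : ℝ × ℝ → β} (hg : Measurable g) :
    iIndepFun (fun i ω => g (V i ω, W i ω)) P :=
  h.indep.comp (fun _ => g) fun _ => hg

lemma countLe_aux (x : ℝ) :
    Measurable (fun p : ℝ × ℝ =>
      (Set.Iic x).indicator (1 : ℝ → ℝ) p.1 - cdf (gaussianReal 0 1) x) ∧
    (∀ v : ℝ, |(Set.Iic x).indicator (1 : ℝ → ℝ) v - cdf (gaussianReal 0 1) x| ≤ 1) ∧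
    ∫ ω, ((Set.Iic x).indicator (1 : ℝ → ℝ) (V 0 ω) - cdf (gaussianReal 0 1) x) ∂P = 0 := by
  have hm : Measurable ((Set.Iic x).indicator (1 : ℝ → ℝ)) :=
    measurable_one.indicator measurableSet_Iic
  refine ⟨(hm.comp measurable_fst).sub_const _, fun v => ?_, ?_⟩
  · have h0 := cdf_nonneg (gaussianReal 0 1) x
    have h1 := cdf_le_one (gaussianReal 0 1) x
    rw [abs_le]
    by_cases hv : v ∈ Set.Iic x
    · rw [Set.indicator_of_mem hv]
      constructor <;> simp <;> linarith
    · rw [Set.indicator_of_notMem hv]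
      constructor <;> linarith
  · rw [h.integral_comp_V 0 (f := fun v => (Set.Iic x).indicator (1 : ℝ → ℝ) v - _)
      (hm.sub_const _)]
    have hi : Integrable ((Set.Iic x).indicator (1 : ℝ → ℝ)) (gaussianReal 0 1) :=
      (integrable_indicator_iff measurableSet_Iic).2 (integrable_const (1 : ℝ)).integrableOn
    rw [integral_sub hi (integrable_const _),
      integral_indicator_one measurableSet_Iic, ← cdf_eq_real]
    simp

variable [IsProbabilityMeasure P]

lemma identDistrib (i : ℕ) : IdentDistrib (fun ω => (V i ω, W i ω)) (fun ω => (V 0 ω, W 0 ω)) P P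
    where
  aemeasurable_fst := ((h.measV i).prodMk (h.measW i)).aemeasurable
  aemeasurable_snd := ((h.measV 0).prodMk (h.measW 0)).aemeasurable
  map_eq := by
    rw [(indepFun_iff_map_prod_eq_prod_map_map (h.measV i).aemeasurable
      (h.measW i).aemeasurable).1 (h.indepVW i), (indepFun_iff_map_prod_eq_prod_map_map
      (h.measV 0).aemeasurable (h.measW 0).aemeasurable).1 (h.indepVW 0), (h.mpV i).map_eq,
      (h.mpV 0).map_eq, (h.mpW i).map_eq, (h.mpW 0).map_eq]

/-- Independence between the pairs and within each pair merge into one independent family, from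
which any disjoint blocks of coordinates can be taken. -/
lemma iIndepFun_prod : iIndepFun (fun (p : ℕ × Bool) ω => bif p.2 then W p.1 ω else V p.1 ω) P := by
  have hm : ∀ (i : ℕ) (j : Bool), Measurable fun ω => bif j then W i ω else V i ω := by
    rintro i (_ | _)
    · exact h.measV i
    · exact h.measW i
  refine iIndepFun_uncurry' (X := fun i j ω => bif j then W i ω else V i ω) hm ?_ ?_
  · exact h.indep.comp (fun _ p j => bif j then p.2 else p.1) fun _ => by
      refine measurable_pi_iff.2 ?_
      rintro (_ | _)
      · exact measurable_fst
      · exact measurable_snd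
  · intro i
    rw [iIndepFun_iff_measure_inter_preimage_eq_mul]
    intro S sets hS
    have hS' : ∀ S : Finset Bool, S = ∅ ∨ S = {false} ∨ S = {true} ∨ S = {false, true} := by decide
    have hi := indepFun_iff_measure_inter_preimage_eq_mul.1 (h.indepVW i)
    rcases hS' S with rfl | rfl | rfl | rfl
    · simp
    · simp
    · simp
    · rw [Finset.set_biInter_insert, Finset.set_biInter_singleton, Finset.prod_pair (by simp)]
      exact hi _ _ (hS false (by simp)) (hS true (by simp))

lemma indepFun_all_prod (n : ℕ) {i j : ℕ} (hij : i ≠ j) :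
    (fun ω => ((fun k : Fin n => V k ω), W j ω)) ⟂ᵢ[P] W i := by
  classical
  set S : Finset (ℕ × Bool) := insert (j, true) ((Finset.range n).image fun k => (k, false))
  have hd : Disjoint S {(i, true)} := by
    simp [S, hij]
  have h1 := h.iIndepFun_prod.indepFun_finset S {(i, true)} hd (by
    rintro ⟨k, _ | _⟩
    · exact h.measV k
    · exact h.measW k)
  refine h1.comp
    (φ := fun x : S → ℝ => ((fun k : Fin n => x ⟨(k, false), by simp [S]⟩), x ⟨(j, true), by simp [S]⟩))
    (ψ := fun x : ({(i, true)} : Finset (ℕ × Bool)) → ℝ => x ⟨(i, true), by simp⟩) ?_ ?_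
  · fun_prop
  · fun_prop

lemma indepFun_all (n i : ℕ) : (fun ω (k : Fin n) => V k ω) ⟂ᵢ[P] W i :=
  (h.indepFun_all_prod n (Nat.succ_ne_self i).symm).comp measurable_fst measurable_id

/-! Sums `∑ g i (V) e (W i)` with coefficients that depend on all the `V k` are uncorrelated sums. -/

lemma integral_sq_sum_cross {n : ℕ} {g : Fin n → (Fin n → ℝ) → ℝ} (hg : ∀ i, Measurable (g i))
    (hg2 : ∀ i, MemLp (fun ω => g i fun k => V k ω) 2 P) {e : ℝ → ℝ} (he : Measurable e)
    (he2 : MemLp e 2 (gaussianReal 0 1)) (he0 : ∫ w, e w ∂(gaussianReal 0 1) = 0) :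
    Integrable (fun ω => (∑ i : Fin n, (g i fun k => V k ω) * e (W i ω)) ^ 2) P ∧
    ∫ ω, (∑ i : Fin n, (g i fun k => V k ω) * e (W i ω)) ^ 2 ∂P
      = (∑ i : Fin n, ∫ ω, (g i fun k => V k ω) ^ 2 ∂P) * ∫ w, e w ^ 2 ∂(gaussianReal 0 1) := by
  have hVs := h.measVs n
  have heW (i : ℕ) : Measurable fun ω => e (W i ω) := he.comp (h.measW i)
  have hgV (i : Fin n) : Measurable fun ω => g i fun k => V k ω := (hg i).comp hVs
  have heL (i : ℕ) : MemLp (fun ω => e (W i ω)) 2 P := he2.comp_measurePreserving (h.mpW i)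
  have hT (i : Fin n) : MemLp (fun ω => (g i fun k => V k ω) * e (W i ω)) 2 P := by
    have hm : Measurable fun ω => (g i fun k => V k ω) * e (W i ω) := (hgV i).mul (heW i)
    rw [memLp_two_iff_integrable_sq hm.aestronglyMeasurable]
    simp_rw [mul_pow]
    -- The squares of the two factors are independent and integrable, so the product is in `L²` and
    -- not merely in `L¹`.
    exact ((h.indepFun_all n i).comp ((hg i).pow_const 2) (he.pow_const 2)).integrable_mul
      (hg2 i).integrable_sq (heL i).integrable_sq
  have hS : MemLp (fun ω => ∑ i : Fin n, (g i fun k => V k ω) * e (W i ω)) 2 P :=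
    memLp_finsetSum _ fun i _ => hT i
  have hTT (i j : Fin n) : Integrable (fun ω => (g i fun k => V k ω) * e (W i ω) *
      ((g j fun k => V k ω) * e (W j ω))) P := (hT i).integrable_mul (hT j)
  refine ⟨hS.integrable_sq, ?_⟩
  simp_rw [sq (∑ i : Fin n, _), Finset.sum_mul_sum]
  rw [integral_finsetSum _ fun i _ => integrable_finsetSum _ fun j _ => hTT i j,
    Finset.sum_mul]
  refine Finset.sum_congr rfl fun i _ => ?_
  rw [integral_finsetSum _ fun j _ => hTT i j,
    Finset.sum_eq_single_of_mem i (Finset.mem_univ _)]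
  · rw [← h.integral_comp_W i (he.pow_const 2)]
    refine Eq.trans ?_ (((h.indepFun_all n i).comp ((hg i).pow_const 2)
      (he.pow_const 2)).integral_fun_mul_eq_mul_integral
      ((hgV i).pow_const 2).aestronglyMeasurable ((heW i).pow_const 2).aestronglyMeasurable)
    refine integral_congr_ae (ae_of_all _ fun ω => ?_)
    simp only [Function.comp_apply]
    ring
  · intro j _ hji
    -- Off the diagonal, `e (W i)` is split off: it is centred and independent of the remaining
    -- factor, a function of all the `V k` and of `W j`.
    have hφ : Measurable fun x : (Fin n → ℝ) × ℝ => g i x.1 * g j x.1 * e x.2 :=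
      (((hg i).comp measurable_fst).mul ((hg j).comp measurable_fst)).mul (he.comp measurable_snd)
    have hij : (i : ℕ) ≠ j := fun hc => hji (Fin.ext hc.symm)
    have := ((h.indepFun_all_prod n hij).comp hφ he).integral_fun_mul_eq_mul_integral
      (hφ.comp (hVs.prodMk (h.measW j))).aestronglyMeasurable (heW i).aestronglyMeasurable
    have h0 : ∫ ω, (e ∘ W i) ω ∂P = 0 := (h.integral_comp_W i he).trans he0
    rw [h0, mul_zero] at this
    rw [← this]
    refine integral_congr_ae (ae_of_all _ fun ω => ?_)
    simp only [Function.comp_apply]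
    ring

/-! ### Counting the values below a threshold -/

lemma identDistrib_comp {β : Type*} [MeasurableSpace β] {g : ℝ × ℝ → β} (hg : Measurable g)
    (i : ℕ) : IdentDistrib (fun ω => g (V i ω, W i ω)) (fun ω => g (V 0 ω, W 0 ω)) P P :=
  (h.identDistrib i).comp hg

lemma nullSeq_countLe (x : ℝ) {c : ℕ → ℝ} (hc : Tendsto (fun n => c n ^ 2 * n) atTop (𝓝 0)) :
    NullSeq P (fun n ω => c n *
      ((countLe x fun k : Fin n => V k ω) - n * cdf (gaussianReal 0 1) x)) := by
  obtain ⟨hm, hb, h0⟩ := h.countLe_aux x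
  simp_rw [countLe_sub_eq]
  exact nullSeq_rpow_mul_sum_iid (h.iIndepFun_comp hm) (h.identDistrib_comp hm)
    (MemLp.of_bound (hm.comp ((h.measV 0).prodMk (h.measW 0))).aestronglyMeasurable 1
      (ae_of_all _ fun ω => hb _)) h0 hc

lemma integral_sq_countLe_le (x : ℝ) (n : ℕ) :
    Integrable (fun ω => ((countLe x fun k : Fin n => V k ω)
      - n * cdf (gaussianReal 0 1) x) ^ 2) P ∧
    ∫ ω, ((countLe x fun k : Fin n => V k ω) - n * cdf (gaussianReal 0 1) x) ^ 2 ∂P ≤ n := by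
  obtain ⟨hm, hb, h0⟩ := h.countLe_aux x
  simp_rw [countLe_sub_eq]
  have hL : MemLp (fun ω => (Set.Iic x).indicator (1 : ℝ → ℝ) (V 0 ω)
      - cdf (gaussianReal 0 1) x) 2 P :=
    (MemLp.of_bound (hm.comp ((h.measV 0).prodMk (h.measW 0))).aestronglyMeasurable 1
      (ae_of_all _ fun ω => hb _))
  have := integral_sq_sum_iid (h.iIndepFun_comp hm) (h.identDistrib_comp hm) hL h0 n
  refine ⟨this.1, this.2.trans_le (mul_le_of_le_one_right (Nat.cast_nonneg _) ?_)⟩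
  calc _ ≤ ∫ _, (1 : ℝ) ∂P := integral_mono hL.integrable_sq (integrable_const _) fun ω => by
        rw [← sq_abs]
        exact pow_le_one₀ (abs_nonneg _) (hb (V 0 ω))
    _ = 1 := by simp

end StdPairs
end Pairs
open scoped Topology

/-! ### Replacing ranks by thresholds -/

section Threshold

variable {Ω : Type*} [MeasurableSpace Ω] {P : Measure Ω} {V W : ℕ → Ω → ℝ}

/-- The difference of the indicators of `i` being among the `[np]` smallest and of
`V i ≤ Φ⁻¹(p)`. -/
noncomputable def rankDiff (p : ℝ) {n : ℕ} (y : Fin n → ℝ) (i : Fin n) : ℝ :=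
  rankBelow ⌊(n : ℝ) * p⌋₊ y i - indLe p (y i)

lemma measurable_rankDiff (p : ℝ) {n : ℕ} (i : Fin n) :
    Measurable fun y : Fin n → ℝ => rankDiff p y i :=
  (measurable_rankBelow _ i).sub ((measurable_indLe p).comp (measurable_pi_apply i))

lemma rankDiff_zero {n : ℕ} (y : Fin n → ℝ) (i : Fin n) : rankDiff 0 y i = 0 := by
  simp [rankDiff, rankBelow, indLe_zero]

lemma rankDiff_one {n : ℕ} (y : Fin n → ℝ) (i : Fin n) : rankDiff 1 y i = 0 := by
  simp [rankDiff, rankBelow, indLe_one]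

lemma floor_mul_le {p : ℝ} (hp : p ≤ 1) (n : ℕ) : ⌊(n : ℝ) * p⌋₊ ≤ n :=
  Nat.floor_le_of_le (mul_le_of_le_one_right (Nat.cast_nonneg _) hp)

lemma rankDiff_eq {p q : ℝ} (hq : PhiInv p = q) {n : ℕ} (y : Fin n → ℝ) (i : Fin n) :
    rankDiff p y i = rankBelow ⌊(n : ℝ) * p⌋₊ y i - rankBelow (countLe q y) y i := by
  rw [rankDiff, rankBelow_countLe, indLe_eq_indicator_Iic hq]

lemma abs_rankDiff_le_one (p : ℝ) {n : ℕ} (y : Fin n → ℝ) (i : Fin n) : |rankDiff p y i| ≤ 1 := by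
  unfold rankDiff
  rcases rankBelow_eq_zero_or_one ⌊(n : ℝ) * p⌋₊ y i with h1 | h1 <;>
  rcases indLe_eq_zero_or_one p (y i) with h2 | h2 <;> simp [h1, h2]

lemma abs_floor_sub_le {p : ℝ} (hp : 0 ≤ p) (n : ℕ) : |(⌊(n : ℝ) * p⌋₊ : ℝ) - n * p| ≤ 1 := by
  have h0 : 0 ≤ (n : ℝ) * p := by positivity
  have h1 := Nat.floor_le h0
  have h2 := Nat.lt_floor_add_one ((n : ℝ) * p)
  rw [abs_le]
  constructor <;> linarith

namespace StdPairs

variable [IsProbabilityMeasure P] (h : StdPairs P V W)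
include h

/-- The distance to `n * p` is at most `1` for the floor and has second moment at most `n` for the
count; `(x + y)² ≤ 2x² + 2y²` combines them. -/
lemma integral_sq_floor_sub_countLe {p q : ℝ} (hp : 0 ≤ p)
    (hc : cdf (gaussianReal 0 1) q = p) (n : ℕ) :
    Integrable (fun ω => ((⌊(n : ℝ) * p⌋₊ : ℝ) - countLe q fun k : Fin n => V k ω) ^ 2) P ∧
    ∫ ω, ((⌊(n : ℝ) * p⌋₊ : ℝ) - countLe q fun k : Fin n => V k ω) ^ 2 ∂P ≤ 2 * n + 2 := by
  obtain ⟨hi, hle⟩ := h.integral_sq_countLe_le q n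
  rw [hc] at hi hle
  have hm : Measurable fun ω => ((countLe q fun k : Fin n => V k ω) : ℝ) := by
    simp_rw [countLe_eq_sum]
    exact Finset.measurable_sum _ fun i _ =>
      (measurable_one.indicator measurableSet_Iic).comp (h.measV i)
  have hb (ω : Ω) : ((⌊(n : ℝ) * p⌋₊ : ℝ) - countLe q fun k : Fin n => V k ω) ^ 2
      ≤ 2 * ((countLe q fun k : Fin n => V k ω) - n * p) ^ 2 + 2 := by
    have h1 : ((⌊(n : ℝ) * p⌋₊ : ℝ) - n * p) ^ 2 ≤ 1 := by
      rw [← sq_abs]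
      exact pow_le_one₀ (abs_nonneg _) (abs_floor_sub_le hp n)
    nlinarith [sq_nonneg (((⌊(n : ℝ) * p⌋₊ : ℝ) - n * p)
      + ((countLe q fun k : Fin n => V k ω) - n * p))]
  have hi2 := (hi.const_mul 2).add (integrable_const (2 : ℝ))
  have hi1 : Integrable (fun ω =>
      ((⌊(n : ℝ) * p⌋₊ : ℝ) - countLe q fun k : Fin n => V k ω) ^ 2) P := by
    refine hi2.mono' ((hm.const_sub _).pow_const 2).aestronglyMeasurable (ae_of_all _ fun ω => ?_)
    rw [Real.norm_of_nonneg (sq_nonneg _)]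
    exact hb ω
  refine ⟨hi1, (integral_mono hi1 hi2 hb).trans ?_⟩
  simp only [Pi.add_apply]
  rw [integral_add (hi.const_mul 2) (integrable_const _), integral_const_mul]
  simp
  linarith

/-- Law of large numbers: the proportion of values at most `x` tends to a limit below `p`. -/
lemma tendsto_measureReal_lt_countLe {p x : ℝ} (hx : cdf (gaussianReal 0 1) x < p) (hp : 0 ≤ p) :
    Tendsto (fun n : ℕ => P.real {ω | ⌊(n : ℝ) * p⌋₊ < countLe x fun k : Fin n => V k ω})
      atTop (𝓝 0) := by
  set F := cdf (gaussianReal 0 1) x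
  have hc : Tendsto (fun n : ℕ => ((n : ℝ)⁻¹) ^ 2 * n) atTop (𝓝 0) := by
    refine (tendsto_inv_atTop_zero.comp tendsto_natCast_atTop_atTop).congr fun n => ?_
    rcases eq_or_ne (n : ℝ) 0 with hn | hn
    · simp [hn]
    · simp; field_simp
  have hnull := h.nullSeq_countLe x hc ((p - F) / 2) (by linarith)
  refine squeeze_zero' (Eventually.of_forall fun _ => measureReal_nonneg) ?_ hnull
  -- From here on, half of the margin `n * (p - F)` absorbs the rounding error `1` of the floor.
  have hev : ∀ᶠ n : ℕ in atTop, 2 / (p - F) ≤ n :=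
    tendsto_natCast_atTop_atTop.eventually_ge_atTop _
  filter_upwards [hev, eventually_gt_atTop 0] with n hn hn0
  refine measureReal_mono fun ω hω => ?_
  have hn0' : (0 : ℝ) < n := by exact_mod_cast hn0
  rw [div_le_iff₀ (by linarith)] at hn
  have h1 := (abs_le.1 (abs_floor_sub_le hp n)).1
  have h2 : (⌊(n : ℝ) * p⌋₊ : ℝ) < countLe x fun k : Fin n => V k ω :=
    Nat.cast_lt.2 (Set.mem_ofPred.1 hω)
  change (p - F) / 2 ≤ |_|
  refine le_trans ?_ (le_abs_self _)
  rw [inv_mul_eq_div, le_div_iff₀ hn0']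
  linarith

lemma tendsto_measureReal_countLe_lt {p x : ℝ} (hx : p < cdf (gaussianReal 0 1) x) (hp : 0 ≤ p) :
    Tendsto (fun n : ℕ => P.real {ω | (countLe x fun k : Fin n => V k ω) < ⌊(n : ℝ) * p⌋₊})
      atTop (𝓝 0) := by
  set F := cdf (gaussianReal 0 1) x
  have hc : Tendsto (fun n : ℕ => ((n : ℝ)⁻¹) ^ 2 * n) atTop (𝓝 0) := by
    refine (tendsto_inv_atTop_zero.comp tendsto_natCast_atTop_atTop).congr fun n => ?_
    rcases eq_or_ne (n : ℝ) 0 with hn | hn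
    · simp [hn]
    · simp; field_simp
  -- The floor rounds down, which helps in this direction, so the full margin is available.
  have hnull := h.nullSeq_countLe x hc (F - p) (by linarith)
  refine squeeze_zero' (Eventually.of_forall fun _ => measureReal_nonneg) ?_ hnull
  filter_upwards [eventually_gt_atTop 0] with n hn0
  refine measureReal_mono fun ω hω => ?_
  have hn0' : (0 : ℝ) < n := by exact_mod_cast hn0
  have h1 := Nat.floor_le (a := (n : ℝ) * p) (by positivity)
  have h2 : ((countLe x fun k : Fin n => V k ω) : ℝ) < ⌊(n : ℝ) * p⌋₊ :=
    Nat.cast_lt.2 (Set.mem_ofPred.1 hω)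
  change F - p ≤ |_|
  refine le_trans ?_ (neg_le_abs _)
  rw [inv_mul_eq_div, ← neg_div, le_div_iff₀ hn0']
  linarith

/-- Replacing ranks by thresholds in a sum of values of a continuous function of the ranked
variable itself. -/
lemma nullSeq_rankDiff_self {p : ℝ} (hp0 : 0 ≤ p) (hp1 : p ≤ 1) {f : ℝ → ℝ} (hf : Continuous f) :
    NullSeq P (fun n ω => (√n)⁻¹ * ∑ i : Fin n,
      rankDiff p (fun k : Fin n => V k ω) i * (f (V i ω) - f (PhiInv p).toReal)) := by
  -- At `p = 0` and `p = 1` ranks and thresholds agree identically, so the real value assigned to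
  -- the infinite quantile is irrelevant.
  rcases hp0.eq_or_lt with rfl | hp0'
  · simpa [rankDiff_zero] using nullSeq_of_tendsto (P := P) (c := fun _ => 0) tendsto_const_nhds
  rcases hp1.eq_or_lt with rfl | hp1'
  · simpa [rankDiff_one] using nullSeq_of_tendsto (P := P) (c := fun _ => 0) tendsto_const_nhds
  obtain ⟨q, hq, hc⟩ := exists_PhiInv_eq hp0' hp1'
  rw [hq, EReal.toReal_coe]
  refine nullSeq_of_eventually_le fun ε hε δ hδ => ?_
  -- Chosen so that `(ε / η)² = 8 / δ`: with `E K² ≤ 2n + 2 ≤ 4n`, Markov's inequality gives `h3`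
  -- with bound `δ / 2`.
  set η : ℝ := ε * √(δ / 8) with hη
  have hηpos : 0 < η := by positivity
  obtain ⟨ρ, hρ, hfρ⟩ := Metric.continuousAt_iff.1 (hf.continuousAt (x := q)) η hηpos
  have hlt : q - ρ / 2 < q := by linarith
  have hgt : q < q + ρ / 2 := by linarith
  have e1 := (h.tendsto_measureReal_lt_countLe (p := p) (x := q - ρ / 2)
    (hc ▸ strictMono_cdf_gaussianReal hlt) hp0).eventually_le_const (u := δ / 4) (by positivity)
  have e2 := (h.tendsto_measureReal_countLe_lt (p := p) (x := q + ρ / 2)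
    (hc ▸ strictMono_cdf_gaussianReal hgt) hp0).eventually_le_const (u := δ / 4) (by positivity)
  filter_upwards [e1, e2, eventually_gt_atTop 0] with n h1 h2 hn
  have hn' : (1 : ℝ) ≤ n := by exact_mod_cast hn
  obtain ⟨hi, hle⟩ := h.integral_sq_floor_sub_countLe hp0 hc n
  set K : Ω → ℝ := fun ω => (⌊(n : ℝ) * p⌋₊ : ℝ) - countLe q fun k : Fin n => V k ω with hK
  have h3 : P.real {ω | (ε / η) ^ 2 * n ≤ K ω ^ 2} ≤ δ / 2 := by
    have hm := mul_meas_ge_le_integral_of_nonneg (ae_of_all P fun ω => sq_nonneg (K ω)) hi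
      ((ε / η) ^ 2 * n)
    have h8 : (ε / η) ^ 2 = 8 / δ := by
      rw [hη, div_pow, mul_pow, Real.sq_sqrt (by positivity)]
      field_simp
    rw [h8] at hm ⊢
    have := hm.trans hle
    have h4 : 8 / δ * n * P.real {x | 8 / δ * n ≤ K x ^ 2} ≤ 4 * n := by linarith
    rw [mul_assoc, mul_left_comm, mul_comm (4 : ℝ)] at h4
    have h5 := le_of_mul_le_mul_left h4 (by positivity)
    rw [div_mul_eq_mul_div, div_le_iff₀ hδ] at h5
    linarith
  -- Outside the first two events, every disagreeing `V i` is within `ρ / 2` of `q` and contributes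
  -- at most `η`; there are `|K|` such indices.
  have hsub : {ω | ε ≤ |(√n)⁻¹ * ∑ i : Fin n,
      rankDiff p (fun k : Fin n => V k ω) i * (f (V i ω) - f q)|} ⊆
      ({ω | ⌊(n : ℝ) * p⌋₊ < countLe (q - ρ / 2) fun k : Fin n => V k ω} ∪
      {ω | (countLe (q + ρ / 2) fun k : Fin n => V k ω) < ⌊(n : ℝ) * p⌋₊}) ∪
      {ω | (ε / η) ^ 2 * n ≤ K ω ^ 2} := by
    intro ω hω
    by_contra hcon
    simp only [Set.mem_union, Set.mem_ofPred_eq, not_or, not_lt, not_le] at hcon hω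
    obtain ⟨⟨c1, c2⟩, c3⟩ := hcon
    have hsum : |∑ i : Fin n, rankDiff p (fun k : Fin n => V k ω) i * (f (V i ω) - f q)|
        ≤ |K ω| * η := by
      rw [hK, ← sum_abs_rankBelow_sub (floor_mul_le hp1 n) (countLe_le q _) fun k : Fin n => V k ω,
        Finset.sum_mul]
      refine (Finset.abs_sum_le_sum_abs _ _).trans (Finset.sum_le_sum fun i _ => ?_)
      rw [abs_mul, rankDiff_eq hq]
      rcases eq_or_ne (rankBelow ⌊(n : ℝ) * p⌋₊ (fun k : Fin n => V k ω) i)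
        (rankBelow (countLe q fun k : Fin n => V k ω) (fun k : Fin n => V k ω) i) with he | he
      · simp [he]
      · refine mul_le_mul_of_nonneg_left ?_ (abs_nonneg _)
        rw [rankBelow_countLe] at he
        have := abs_sub_le_of_rankBelow_ne he c1 c2
        exact (hfρ (by rw [Real.dist_eq]; linarith)).le
    rw [abs_mul, abs_of_nonneg (by positivity), inv_mul_eq_div, le_div_iff₀ (by positivity)] at hω
    have h6 : ε / η * √n ≤ |K ω| := by
      rw [div_mul_eq_mul_div, div_le_iff₀ hηpos]
      exact hω.trans hsum
    have h7 : (ε / η * √n) ^ 2 ≤ |K ω| ^ 2 := pow_le_pow_left₀ (by positivity) h6 2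
    rw [mul_pow, Real.sq_sqrt (by positivity), sq_abs] at h7
    linarith
  have m1 := measureReal_mono (μ := P) hsub
  have m2 := measureReal_union_le (μ := P)
    ({ω | ⌊(n : ℝ) * p⌋₊ < countLe (q - ρ / 2) fun k : Fin n => V k ω} ∪
      {ω | (countLe (q + ρ / 2) fun k : Fin n => V k ω) < ⌊(n : ℝ) * p⌋₊})
    {ω | (ε / η) ^ 2 * n ≤ K ω ^ 2}
  have m3 := measureReal_union_le (μ := P)
    {ω | ⌊(n : ℝ) * p⌋₊ < countLe (q - ρ / 2) fun k : Fin n => V k ω}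
    {ω | (countLe (q + ρ / 2) fun k : Fin n => V k ω) < ⌊(n : ℝ) * p⌋₊}
  linarith

/-- Replacing ranks by thresholds in a sum of products with centred functions of the independent
variables. -/
lemma nullSeq_rankDiff_cross {p : ℝ} (hp0 : 0 ≤ p) (hp1 : p ≤ 1) {g e : ℝ → ℝ} (hg : Measurable g)
    (hg4 : Integrable (fun v => g v ^ 4) (gaussianReal 0 1)) (he : Measurable e)
    (he2 : MemLp e 2 (gaussianReal 0 1)) (he0 : ∫ w, e w ∂(gaussianReal 0 1) = 0) :
    NullSeq P (fun n ω => (√n)⁻¹ * ∑ i : Fin n,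
      rankDiff p (fun k : Fin n => V k ω) i * (g (V i ω) * e (W i ω))) := by
  rcases hp0.eq_or_lt with rfl | hp0'
  · simpa [rankDiff_zero] using nullSeq_of_tendsto (P := P) (c := fun _ => 0) tendsto_const_nhds
  rcases hp1.eq_or_lt with rfl | hp1'
  · simpa [rankDiff_one] using nullSeq_of_tendsto (P := P) (c := fun _ => 0) tendsto_const_nhds
  obtain ⟨q, hq, hc⟩ := exists_PhiInv_eq hp0' hp1'
  set M := ∫ v, g v ^ 4 ∂(gaussianReal 0 1) with hM
  have hg2 : Integrable (fun v => g v ^ 2) (gaussianReal 0 1) := by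
    refine (hg4.add (integrable_const (1 : ℝ))).mono' (hg.pow_const 2).aestronglyMeasurable
      (ae_of_all _ fun v => ?_)
    rw [Real.norm_of_nonneg (sq_nonneg _)]
    simp only [Pi.add_apply]
    nlinarith [sq_nonneg (g v ^ 2 - 1)]
  have hcoef (n : ℕ) (i : Fin n) : Measurable fun y : Fin n → ℝ => rankDiff p y i * g (y i) :=
    (measurable_rankDiff p i).mul (hg.comp (measurable_pi_apply i))
  have hgV (i : ℕ) : MemLp (fun ω => g (V i ω)) 2 P :=
    ((memLp_two_iff_integrable_sq hg.aestronglyMeasurable).2 hg2).comp_measurePreserving (h.mpV i)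
  have hL (n : ℕ) (i : Fin n) :
      MemLp (fun ω => rankDiff p (fun k : Fin n => V k ω) i * g (V i ω)) 2 P := by
    refine (hgV i).mono ((hcoef n i).comp (h.measVs n)).aestronglyMeasurable
      (ae_of_all _ fun ω => ?_)
    rw [norm_mul, Real.norm_eq_abs]
    exact mul_le_of_le_one_left (norm_nonneg _) (abs_rankDiff_le_one _ _ _)
  have hx (n : ℕ) := h.integral_sq_sum_cross (hcoef n) (hL n) he he2 he0
  simp_rw [← mul_assoc (rankDiff p _ _)]
  -- By uncorrelatedness only the squared coefficients matter. With `x = n^(1/4)` their expected sum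
  -- is bounded by `(5/4 + M/2) x³`, which is `o(n)`.
  have hbound (n : ℕ) (hn : 0 < n) :
      (n : ℝ)⁻¹ * ∑ i : Fin n, ∫ ω, (rankDiff p (fun k : Fin n => V k ω) i * g (V i ω)) ^ 2 ∂P
        ≤ (5 / 4 + M / 2) * (√√(n : ℝ))⁻¹ := by
    have hn' : (1 : ℝ) ≤ n := by exact_mod_cast hn
    obtain ⟨hi, hle⟩ := h.integral_sq_floor_sub_countLe hp0 hc n
    set K : Ω → ℝ := fun ω => (⌊(n : ℝ) * p⌋₊ : ℝ) - countLe q fun k : Fin n => V k ω with hK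
    set x := √√(n : ℝ) with hxdef
    have hx0 : 0 < x := by positivity
    have hxn : (n : ℝ) = x ^ 4 := by
      rw [show x ^ 4 = (x ^ 2) ^ 2 by ring, hxdef, Real.sq_sqrt (by positivity),
        Real.sq_sqrt (by positivity)]
    have hpt (ω : Ω) :
        ∑ i : Fin n, (rankDiff p (fun k : Fin n => V k ω) i * g (V i ω)) ^ 2
          ≤ (4 * x)⁻¹ * K ω ^ 2 + (x ^ 3 / 4 + ∑ i : Fin n, (2 * x)⁻¹ * g (V i ω) ^ 4) := by
      have h1 : ∑ i : Fin n, (rankDiff p (fun k : Fin n => V k ω) i * g (V i ω)) ^ 2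
          ≤ ∑ i : Fin n, (x / 2 * |rankDiff p (fun k : Fin n => V k ω) i|
            + (2 * x)⁻¹ * g (V i ω) ^ 4) := by
        refine Finset.sum_le_sum fun i _ => ?_
        have hD := abs_rankDiff_le_one p (fun k : Fin n => V k ω) i
        have hD0 := abs_nonneg (rankDiff p (fun k : Fin n => V k ω) i)
        rw [mul_pow, ← sq_abs (rankDiff p _ i)]
        set d := |rankDiff p (fun k : Fin n => V k ω) i|
        set t := g (V i ω) ^ 2 with ht
        have ht4 : g (V i ω) ^ 4 = t ^ 2 := by rw [ht]; ring
        have ht0 : 0 ≤ t := sq_nonneg _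
        rw [ht4]
        have e1 : d ^ 2 * t ≤ d * t := by nlinarith [mul_nonneg hD0 ht0]
        -- Weighted arithmetic-geometric mean inequality: it separates the sparse factor `d ≤ 1`
        -- from `g²`, at the cost of a fourth moment of `g`.
        have e2 : 2 * x * (d * t) ≤ x ^ 2 * d + t ^ 2 := by
          nlinarith [mul_nonneg hD0 (sq_nonneg (x - t)), sq_nonneg t]
        have e3 : d * t ≤ (2 * x)⁻¹ * (x ^ 2 * d + t ^ 2) := by
          rw [inv_mul_eq_div, le_div_iff₀ (by positivity)]
          linarith
        refine e1.trans (e3.trans_eq ?_)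
        field_simp
      refine h1.trans ?_
      rw [Finset.sum_add_distrib, ← Finset.mul_sum, ← add_assoc]
      refine add_le_add ?_ le_rfl
      simp_rw [rankDiff_eq hq]
      rw [sum_abs_rankBelow_sub (floor_mul_le hp1 n) (countLe_le q _)]
      change x / 2 * |K ω| ≤ _
      rw [← sq_abs (K ω)]
      -- Completing the square trades `|K|` for `K²`, whose expectation is at most `4n = 4x⁴`.
      have e4 : (4 * x)⁻¹ * |K ω| ^ 2 + x ^ 3 / 4 - x / 2 * |K ω|
          = (4 * x)⁻¹ * (|K ω| - x ^ 2) ^ 2 := by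
        field_simp
        ring
      have : 0 ≤ (4 * x)⁻¹ * (|K ω| - x ^ 2) ^ 2 := by positivity
      linarith
    have hg4V (i : ℕ) : Integrable (fun ω => g (V i ω) ^ 4) P :=
      (h.mpV i).integrable_comp_of_integrable hg4
    have hI2 : Integrable (fun ω => ∑ i : Fin n, (2 * x)⁻¹ * g (V i ω) ^ 4) P :=
      integrable_finsetSum _ fun i _ => (hg4V i).const_mul _
    have hI4 : ∫ ω, ∑ i : Fin n, (2 * x)⁻¹ * g (V i ω) ^ 4 ∂P = n * ((2 * x)⁻¹ * M) := by
      rw [integral_finsetSum _ fun i _ => (hg4V _).const_mul _]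
      simp_rw [integral_const_mul, h.integral_comp_V _ (hg.pow_const 4)]
      rw [← hM]
      simp
    have hI3 : Integrable (fun ω => x ^ 3 / 4 + ∑ i : Fin n, (2 * x)⁻¹ * g (V i ω) ^ 4) P :=
      (integrable_const _).add hI2
    have hint := integral_mono (μ := P) (integrable_finsetSum _ fun i _ => (hL n i).integrable_sq)
      ((hi.const_mul (4 * x)⁻¹).add hI3) hpt
    rw [integral_finsetSum _ fun i _ => (hL n i).integrable_sq] at hint
    simp only [Pi.add_apply] at hint
    rw [integral_add (hi.const_mul _) hI3, integral_add (integrable_const _) hI2, hI4,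
      integral_const_mul] at hint
    simp only [integral_const, probReal_univ, one_smul] at hint
    rw [inv_mul_eq_div, div_le_iff₀ (by positivity)]
    refine hint.trans ?_
    have e5 : (4 * x)⁻¹ * ∫ ω, K ω ^ 2 ∂P ≤ (4 * x)⁻¹ * (4 * n) :=
      mul_le_mul_of_nonneg_left (hle.trans (by linarith)) (by positivity)
    have e6 : (4 * x)⁻¹ * (4 * n) + (x ^ 3 / 4 + n * ((2 * x)⁻¹ * M))
        = (5 / 4 + M / 2) * x⁻¹ * n := by
      rw [hxn]
      field_simp
      ring
    linarith
  refine nullSeq_of_tendsto_integral_sq (fun n => ?_) ?_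
  · simp_rw [mul_pow]
    exact (hx n).1.const_mul _
  · have hlim : Tendsto (fun n : ℕ => (5 / 4 + M / 2) * (√√(n : ℝ))⁻¹ *
        ∫ w, e w ^ 2 ∂(gaussianReal 0 1)) atTop (𝓝 0) := by
      have : Tendsto (fun n : ℕ => (√√(n : ℝ))⁻¹) atTop (𝓝 0) :=
        tendsto_inv_atTop_zero.comp (Real.tendsto_sqrt_atTop.comp
          (Real.tendsto_sqrt_atTop.comp tendsto_natCast_atTop_atTop))
      simpa using (this.const_mul (5 / 4 + M / 2)).mul_const _
    refine squeeze_zero' (Eventually.of_forall fun _ => integral_nonneg fun _ => sq_nonneg _) ?_ hlim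
    filter_upwards [eventually_gt_atTop 0] with n hn
    simp_rw [mul_pow]
    rw [integral_const_mul, (hx n).2, ← mul_assoc, inv_pow, Real.sq_sqrt (Nat.cast_nonneg n)]
    exact mul_le_mul_of_nonneg_right (hbound n hn) (integral_nonneg fun _ => sq_nonneg _)

end StdPairs

end Threshold

open scoped Topology

/-! ### Linear representations of the ranked means -/

section Representation

lemma tendsto_floor_div {p : ℝ} (hp : 0 ≤ p) :
    Tendsto (fun n : ℕ => (⌊(n : ℝ) * p⌋₊ : ℝ) / n) atTop (𝓝 p) := by
  refine ((tendsto_nat_floor_mul_div_atTop hp).comp tendsto_natCast_atTop_atTop).congr fun n => ?_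
  simp [mul_comm]

lemma subsampleSize_cast {a b : ℝ} (hab : a ≤ b) (n : ℕ) :
    (subsampleSize a b n : ℝ) = ⌊(n : ℝ) * b⌋₊ - ⌊(n : ℝ) * a⌋₊ := by
  rw [subsampleSize, Nat.cast_sub (Nat.floor_mono (by gcongr))]

lemma tendsto_div_subsampleSize {a b : ℝ} (ha : 0 ≤ a) (hab : a < b) :
    Tendsto (fun n : ℕ => (n : ℝ) / subsampleSize a b n) atTop (𝓝 (1 / (b - a))) := by
  have h := ((tendsto_floor_div (ha.trans hab.le)).sub (tendsto_floor_div ha)).inv₀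
    (sub_pos.2 hab).ne'
  rw [one_div]
  refine h.congr fun n => ?_
  rw [← sub_div, ← subsampleSize_cast hab.le, inv_div]

lemma eventually_subsampleSize_ne_zero {a b : ℝ} (ha : 0 ≤ a) (hab : a < b) :
    ∀ᶠ n : ℕ in atTop, subsampleSize a b n ≠ 0 := by
  have h := tendsto_div_subsampleSize ha hab
  have hpos : 0 < 1 / (b - a) := by
    have := sub_pos.2 hab
    positivity
  -- An empty subsample would make the quotient `0`, since `n / 0 = 0`.
  filter_upwards [h.eventually_const_lt hpos] with n hn h0
  simp [h0] at hn

lemma rankedMean_eq_rankDiff {a b : ℝ} (hab : a ≤ b) {n : ℕ} (y z : Fin n → ℝ) :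
    rankedMean a b y z = (1 / (subsampleSize a b n : ℝ)) *
      ((∑ i, rankDiff b y i * z i - ∑ i, rankDiff a y i * z i)
        + ∑ i, (indLe b (y i) - indLe a (y i)) * z i) := by
  rw [rankedMean_eq hab, ← Finset.sum_sub_distrib, ← Finset.sum_add_distrib]
  congr 1
  refine Finset.sum_congr rfl fun i _ => ?_
  simp only [rankDiff]
  ring

variable {Ω : Type*} [MeasurableSpace Ω] {P : Measure Ω} {V W : ℕ → Ω → ℝ}

namespace StdPairs

variable (h : StdPairs P V W)
include h

lemma indicator_setAV_ae {a b : ℝ} (ha : 0 ≤ a) (hab : a < b) (hb : b ≤ 1) :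
    ∀ᵐ ω ∂P, ∀ i, ∀ f : ℝ → ℝ,
      (setAV a b).indicator f (V i ω) = (indLe b (V i ω) - indLe a (V i ω)) * f (V i ω) :=
  ae_all_iff.2 fun i =>
    (h.mpV i).quasiMeasurePreserving.ae (QuantileCov.indicator_setAV_ae ha hab hb)

variable [IsProbabilityMeasure P]

/-- The linear representation of the ranked mean of `V ^ k`. -/
lemma nullSeq_rankedMean_pow {a b : ℝ} (ha : 0 ≤ a) (hab : a < b) (hb : b ≤ 1) (k : ℕ) (l : ℝ) :
    NullSeq P (fun n ω => √n * (rankedMean a b (fun i : Fin n => V i ω)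
        (fun i : Fin n => V i ω ^ k) - l)
      - √n / subsampleSize a b n * ∑ i ∈ Finset.range n, trimRep a b k l (V i ω)) := by
  have hf : Continuous fun v : ℝ => v ^ k - l := by fun_prop
  have hRa := h.nullSeq_rankDiff_self ha (hab.le.trans hb) hf
  have hRb := h.nullSeq_rankDiff_self (ha.trans hab.le) hb hf
  -- `trimRep` centres the counts at `n * p`, whereas the ranks use its integer part; the
  -- discrepancy is at most `(√n)⁻¹`.
  have hfl {p : ℝ} (hp : 0 ≤ p) :
      NullSeq P (fun (n : ℕ) (_ : Ω) => ((⌊(n : ℝ) * p⌋₊ : ℝ) - n * p) * (√n)⁻¹) := by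
    refine nullSeq_of_tendsto ?_
    have h0 : Tendsto (fun n : ℕ => (√(n : ℝ))⁻¹) atTop (𝓝 0) :=
      tendsto_inv_atTop_zero.comp (Real.tendsto_sqrt_atTop.comp tendsto_natCast_atTop_atTop)
    refine squeeze_zero_norm (fun n => ?_) h0
    rw [norm_mul, Real.norm_eq_abs, Real.norm_of_nonneg (by positivity)]
    exact mul_le_of_le_one_left (by positivity) (abs_floor_sub_le hp n)
  have hall := ((hRb.sub hRa).add (((hfl (ha.trans hab.le)).const_mul
    ((PhiInv b).toReal ^ k - l)).sub ((hfl ha).const_mul ((PhiInv a).toReal ^ k - l)))).mul_tendsto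
    (tendsto_div_subsampleSize ha hab)
  refine hall.congr' ?_
  filter_upwards [eventually_subsampleSize_ne_zero ha hab, eventually_gt_atTop 0] with n hm hn
  filter_upwards [h.indicator_setAV_ae ha hab hb] with ω hω
  have hm' : (subsampleSize a b n : ℝ) ≠ 0 := by exact_mod_cast hm
  have hsn : √(n : ℝ) ≠ 0 := by positivity
  have hsq : (n : ℝ) = √(n : ℝ) * √(n : ℝ) := (Real.mul_self_sqrt (Nat.cast_nonneg n)).symm
  have h1 : rankedMean a b (fun i : Fin n => V i ω) (fun i : Fin n => V i ω ^ k)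
      = rankedMean a b (fun i : Fin n => V i ω) (fun i : Fin n => V i ω ^ k - l) + l := by
    have := rankedMean_add a b (fun i : Fin n => V i ω) (fun i : Fin n => V i ω ^ k - l) fun _ => l
    rw [rankedMean_const hab.le hb hm] at this
    simpa using this
  have h2 : ∑ i ∈ Finset.range n, trimRep a b k l (V i ω)
      = ∑ i : Fin n, (indLe b (V i ω) - indLe a (V i ω)) * (V i ω ^ k - l)
        + (∑ i : Fin n, indLe a (V i ω) - n * a) * ((PhiInv a).toReal ^ k - l)
        + (n * b - ∑ i : Fin n, indLe b (V i ω)) * ((PhiInv b).toReal ^ k - l) := by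
    rw [← Fin.sum_univ_eq_sum_range (fun i => trimRep a b k l (V i ω)) n]
    simp only [trimRep, hω]
    rw [Finset.sum_add_distrib, Finset.sum_add_distrib, ← Finset.sum_mul, ← Finset.sum_mul,
      Finset.sum_sub_distrib, Finset.sum_sub_distrib]
    simp
  -- Subtracting the value of the function at the quantile isolates the null part. The rest is that
  -- value times the sum of the rank differences, which is exactly `[np]` minus a count; this is the
  -- source of the boundary terms.
  have h3 (p : ℝ) (hp : p ≤ 1) :
      ∑ i : Fin n, rankDiff p (fun i : Fin n => V i ω) i * (V i ω ^ k - l)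
      = ∑ i : Fin n, rankDiff p (fun i : Fin n => V i ω) i
          * ((V i ω ^ k - l) - ((PhiInv p).toReal ^ k - l))
        + (⌊(n : ℝ) * p⌋₊ - ∑ i : Fin n, indLe p (V i ω)) * ((PhiInv p).toReal ^ k - l) := by
    have hD : (⌊(n : ℝ) * p⌋₊ : ℝ) - ∑ i : Fin n, indLe p (V i ω)
        = ∑ i : Fin n, rankDiff p (fun i : Fin n => V i ω) i := by
      simp only [rankDiff]
      rw [Finset.sum_sub_distrib, sum_rankBelow (floor_mul_le hp n)]
    rw [hD, Finset.sum_mul, ← Finset.sum_add_distrib]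
    refine Finset.sum_congr rfl fun i _ => ?_
    ring
  rw [h1, h2, rankedMean_eq_rankDiff hab.le, h3 b hb, h3 a (hab.le.trans hb)]
  generalize ∑ i : Fin n, rankDiff b (fun i : Fin n => V i ω) i
          * ((V i ω ^ k - l) - ((PhiInv b).toReal ^ k - l)) = Rb
  generalize ∑ i : Fin n, rankDiff a (fun i : Fin n => V i ω) i
          * ((V i ω ^ k - l) - ((PhiInv a).toReal ^ k - l)) = Ra
  generalize ∑ i : Fin n, (indLe b (V i ω) - indLe a (V i ω)) * (V i ω ^ k - l) = S
  generalize ∑ i : Fin n, indLe b (V i ω) = Nb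
  generalize ∑ i : Fin n, indLe a (V i ω) = Na
  generalize (PhiInv b).toReal ^ k - l = fb
  generalize (PhiInv a).toReal ^ k - l = fa
  field_simp
  rw [Real.sq_sqrt (Nat.cast_nonneg n)]
  ring

/-- The linear representation of the ranked mean of a product with a centred function of `W`. -/
lemma nullSeq_rankedMean_cross {a b : ℝ} (ha : 0 ≤ a) (hab : a < b) (hb : b ≤ 1) {g e : ℝ → ℝ}
    (hg : Measurable g) (hg4 : Integrable (fun v => g v ^ 4) (gaussianReal 0 1))
    (he : Measurable e) (he2 : MemLp e 2 (gaussianReal 0 1))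
    (he0 : ∫ w, e w ∂(gaussianReal 0 1) = 0) :
    NullSeq P (fun n ω => √n * rankedMean a b (fun i : Fin n => V i ω)
        (fun i : Fin n => g (V i ω) * e (W i ω))
      - √n / subsampleSize a b n * ∑ i ∈ Finset.range n,
        (setAV a b).indicator (fun v => g v * e (W i ω)) (V i ω)) := by
  have hRa := h.nullSeq_rankDiff_cross ha (hab.le.trans hb) hg hg4 he he2 he0
  have hRb := h.nullSeq_rankDiff_cross (ha.trans hab.le) hb hg hg4 he he2 he0
  refine ((hRb.sub hRa).mul_tendsto (tendsto_div_subsampleSize ha hab)).congr' ?_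
  filter_upwards [eventually_gt_atTop 0] with n hn
  filter_upwards [h.indicator_setAV_ae ha hab hb] with ω hω
  have hsn : √(n : ℝ) ≠ 0 := by positivity
  rw [← Fin.sum_univ_eq_sum_range
    (fun i => (setAV a b).indicator (fun v => g v * e (W i ω)) (V i ω)) n]
  simp only [hω, rankedMean_eq_rankDiff hab.le]
  have hsq : (n : ℝ) / subsampleSize a b n = √n / subsampleSize a b n * √n := by
    rw [div_mul_eq_mul_div, Real.mul_self_sqrt (Nat.cast_nonneg n)]
  rw [hsq, mul_assoc, mul_sub, ← mul_assoc, ← mul_assoc, mul_inv_cancel₀ hsn]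
  ring

end StdPairs

end Representation

open scoped Topology

/-! ### Covariance matrices and the central limit theorem with a normal limit vector -/

section NormalLimit

open scoped RealInnerProductSpace

variable {Ω : Type*} [MeasurableSpace Ω] {P : Measure Ω} [IsProbabilityMeasure P]
  {ι : Type*} [Fintype ι]

/-- The quadratic form as a variance gives both positive semidefiniteness and the variances needed
for the Cramér–Wold device. -/
lemma dotProduct_covariance_mulVec {ξ : Ω → EuclideanSpace ℝ ι} (hξ : MemLp ξ 2 P) (c : ℝ)
    (t : ι → ℝ) :
    t ⬝ᵥ (Matrix.of fun k l => c * cov[fun ω => ξ ω k, fun ω => ξ ω l; P]).mulVec t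
      = c * Var[fun ω => ⟪WithLp.toLp 2 t, ξ ω⟫; P] := by
  have hξ' (i : ι) : MemLp (fun ω => ξ ω i) 2 P := memLp_piLp_iff.1 hξ i
  have hin : (fun ω => ⟪WithLp.toLp 2 t, ξ ω⟫) = fun ω => ∑ i, t i * ξ ω i := by
    ext ω
    simp [PiLp.inner_apply, mul_comm]
  rw [hin, variance_fun_sum fun i => (hξ' i).const_mul (t i)]
  simp only [dotProduct, Matrix.mulVec, Matrix.of_apply, Finset.mul_sum]
  refine Finset.sum_congr rfl fun k _ => Finset.sum_congr rfl fun l _ => ?_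
  rw [covariance_const_mul_left, covariance_const_mul_right]
  ring

lemma posSemidef_covariance {ξ : Ω → EuclideanSpace ℝ ι} (hξ : MemLp ξ 2 P) {c : ℝ} (hc : 0 ≤ c) :
    (Matrix.of fun k l => c * cov[fun ω => ξ ω k, fun ω => ξ ω l; P]).PosSemidef := by
  refine .of_dotProduct_mulVec_nonneg ?_ fun x => ?_
  · ext k l
    simp [covariance_comm]
  · rw [star_trivial, dotProduct_covariance_mulVec hξ]
    exact mul_nonneg hc (variance_nonneg _ _)

lemma hasLaw_inner_multivariateGaussian [DecidableEq ι] {Ω' : Type*} [MeasurableSpace Ω']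
    {Q : Measure Ω'} {L : Ω' → EuclideanSpace ℝ ι} {S : Matrix ι ι ℝ} (hS : S.PosSemidef)
    (hL : HasLaw L (multivariateGaussian 0 S) Q) (t : EuclideanSpace ℝ ι) :
    HasLaw (fun ω' => ⟪t, L ω'⟫)
      (gaussianReal 0 ((WithLp.ofLp t) ⬝ᵥ S.mulVec (WithLp.ofLp t)).toNNReal) Q := by
  have h1 := IsGaussian.map_eq_gaussianReal (μ := multivariateGaussian 0 S) (innerSL ℝ t)
  have hmean : ∫ x, innerSL ℝ t x ∂(multivariateGaussian 0 S) = 0 := by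
    rw [(innerSL ℝ t).integral_comp_id_comm IsGaussian.integrable_id]
    simp
  have hvar : Var[innerSL ℝ t; multivariateGaussian 0 S]
      = (WithLp.ofLp t) ⬝ᵥ S.mulVec (WithLp.ofLp t) := by
    rw [← covarianceBilin_multivariateGaussian (μ := 0) hS,
      covarianceBilin_self IsGaussian.memLp_two_id]
    rfl
  rw [hmean, hvar] at h1
  exact HasLaw.comp (Y := innerSL ℝ t) ⟨by fun_prop, h1⟩ hL

/-- The **multivariate central limit theorem**. -/
theorem tendstoInDistribution_smul_sum_multivariateGaussian [DecidableEq ι] {Ω' : Type*}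
    [MeasurableSpace Ω'] {Q : Measure Ω'} [IsProbabilityMeasure Q]
    {ξ : ℕ → Ω → EuclideanSpace ℝ ι} {L : Ω' → EuclideanSpace ℝ ι} (hind : iIndepFun ξ P)
    (hid : ∀ i, IdentDistrib (ξ i) (ξ 0) P P) (hmeas : ∀ i, Measurable (ξ i))
    (hL2 : MemLp (ξ 0) 2 P) (h0 : ∫ ω, ξ 0 ω ∂P = 0)
    {c : ℝ} (hc : c ≠ 0) {d : ℕ → ℝ} (hd : Tendsto (fun n => d n * √n) atTop (𝓝 c))
    (hL : HasLaw L (multivariateGaussian 0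
      (Matrix.of fun k l => c ^ 2 * cov[fun ω => ξ 0 ω k, fun ω => ξ 0 ω l; P])) Q) :
    TendstoInDistribution (fun n ω => d n • ∑ i ∈ Finset.range n, ξ i ω) atTop L
      (fun _ => P) Q := by
  refine tendstoInDistribution_smul_sum_iid hind hid hmeas hL2 h0 hc hd hL.aemeasurable fun t => ?_
  have := hasLaw_inner_multivariateGaussian (posSemidef_covariance hL2 (sq_nonneg c)) hL t
  rwa [dotProduct_covariance_mulVec hL2] at this

end NormalLimit

/-! ### Moments of the representation variables -/

section Moments

lemma memLp_pow_gaussianReal (k : ℕ) : MemLp (fun v : ℝ => v ^ k) 2 (gaussianReal 0 1) := by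
  rw [memLp_two_iff_integrable_sq (by fun_prop)]
  simp_rw [← pow_mul]
  have h := (memLp_id_gaussianReal (μ := 0) (v := 1) ((k * 2 : ℕ) : NNReal)).integrable_norm_pow'
  rw [← integrable_norm_iff (by fun_prop)]
  simpa using h

lemma integrable_pow_gaussianReal (k : ℕ) : Integrable (fun v : ℝ => v ^ k) (gaussianReal 0 1) :=
  (memLp_pow_gaussianReal k).integrable (by norm_num)

lemma integral_sq_gaussianReal : ∫ v, v ^ 2 ∂(gaussianReal 0 1) = 1 := by
  have h := variance_of_integral_eq_zero (μ := gaussianReal 0 1) aemeasurable_id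
    (by simp [integral_id_gaussianReal])
  rw [variance_id_gaussianReal] at h
  simpa using h.symm

/-- The representation vector as a function of the standardised pair. -/
noncomputable def pairZ (a b l₁ l₂ : ℝ) (p : ℝ × ℝ) : EuclideanSpace ℝ (Fin 5) :=
  !₂[trimRep a b 1 l₁ p.1, trimRep a b 2 l₂ p.1,
    Set.indicator (setAV a b) (fun v => v * p.2) p.1,
    Set.indicator (setAV a b) (fun _ => p.2) p.1,
    Set.indicator (setAV a b) (fun _ => p.2 ^ 2 - 1) p.1]

lemma measurable_trimRep (a b : ℝ) (k : ℕ) (l : ℝ) : Measurable (trimRep a b k l) := by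
  unfold trimRep
  have h1 := measurable_indLe a
  have h2 := measurable_indLe b
  have h3 : Measurable ((setAV a b).indicator fun v : ℝ => v ^ k - l) :=
    (by fun_prop : Measurable fun v : ℝ => v ^ k - l).indicator (measurableSet_setAV a b)
  fun_prop

lemma indicator_setAV_mul (a b : ℝ) (g : ℝ → ℝ) (v w : ℝ) :
    (setAV a b).indicator (fun v => g v * w) v = (setAV a b).indicator g v * w := by
  by_cases hv : v ∈ setAV a b <;> simp [hv]

/-- In this product form, independence of `V` and `W` factorises the moments of the last three
coordinates. -/
lemma pairZ_eq (a b l₁ l₂ : ℝ) (p : ℝ × ℝ) : pairZ a b l₁ l₂ p =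
    !₂[trimRep a b 1 l₁ p.1, trimRep a b 2 l₂ p.1,
      (setAV a b).indicator id p.1 * p.2, (setAV a b).indicator 1 p.1 * p.2,
      (setAV a b).indicator 1 p.1 * (p.2 ^ 2 - 1)] := by
  have h1 := indicator_setAV_mul a b id p.1 p.2
  have h2 := indicator_setAV_mul a b 1 p.1 p.2
  have h3 := indicator_setAV_mul a b 1 p.1 (p.2 ^ 2 - 1)
  simp only [id_eq, Pi.one_apply, one_mul] at h1 h2 h3
  rw [pairZ, h1, h2, h3]

lemma measurable_pairZ (a b l₁ l₂ : ℝ) : Measurable (pairZ a b l₁ l₂) := by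
  have h1 := measurable_trimRep a b 1 l₁
  have h2 := measurable_trimRep a b 2 l₂
  have h3 : Measurable ((setAV a b).indicator (id : ℝ → ℝ)) :=
    measurable_id.indicator (measurableSet_setAV a b)
  have h4 : Measurable ((setAV a b).indicator (1 : ℝ → ℝ)) :=
    measurable_one.indicator (measurableSet_setAV a b)
  simp_rw [funext (pairZ_eq a b l₁ l₂)]
  refine (WithLp.measurable_toLp 2 _).comp (measurable_pi_iff.2 fun i => ?_)
  fin_cases i <;> simp <;> fun_prop

variable {a b : ℝ}

/-- The moment `E[V ^ k | V ∈ A_V]` of a standard normal variable. -/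
noncomputable def stdLam (a b : ℝ) (k : ℕ) : ℝ :=
  (b - a)⁻¹ * ∫ v, (setAV a b).indicator (fun v => v ^ k) v ∂(gaussianReal 0 1)

lemma memLp_indicator_pow (a b : ℝ) (k : ℕ) :
    MemLp ((setAV a b).indicator fun v => v ^ k) 2 (gaussianReal 0 1) :=
  (memLp_pow_gaussianReal k).indicator (measurableSet_setAV a b)

lemma memLp_indLe (p : ℝ) : MemLp (indLe p) 2 (gaussianReal 0 1) := by
  refine MemLp.of_bound (measurable_indLe p).aestronglyMeasurable 1 (ae_of_all _ fun v => ?_)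
  rcases indLe_eq_zero_or_one p v with h | h <;> simp [h]

lemma memLp_trimRep (a b : ℝ) (k : ℕ) (l : ℝ) :
    MemLp (trimRep a b k l) 2 (gaussianReal 0 1) := by
  have h0 : MemLp ((setAV a b).indicator fun v => v ^ k - l) 2 (gaussianReal 0 1) :=
    ((memLp_pow_gaussianReal k).sub (memLp_const l)).indicator (measurableSet_setAV a b)
  exact (h0.add (((memLp_indLe a).sub (memLp_const a)).mul_const _)).add
    (((memLp_const b).sub (memLp_indLe b)).mul_const _)

/-- The trimmed term is centred by the choice of `stdLam`, and the boundary terms because `V ≤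
Φ⁻¹(p)` has probability `p`, also for `p = 0` and `p = 1`. -/
lemma integral_trimRep (ha : 0 ≤ a) (hab : a < b) (hb : b ≤ 1) (k : ℕ) :
    ∫ v, trimRep a b k (stdLam a b k) v ∂(gaussianReal 0 1) = 0 := by
  have hpos := sub_pos.2 hab
  have h0 : MemLp ((setAV a b).indicator fun v => v ^ k - stdLam a b k) 2 (gaussianReal 0 1) :=
    ((memLp_pow_gaussianReal k).sub (memLp_const _)).indicator (measurableSet_setAV a b)
  have hi0 := h0.integrable (by norm_num)
  have hia := ((integrable_indLe a).sub (integrable_const a)).mul_const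
    ((PhiInv a).toReal ^ k - stdLam a b k)
  have hib := ((integrable_const b).sub (integrable_indLe b)).mul_const
    ((PhiInv b).toReal ^ k - stdLam a b k)
  have e0 : ∫ v, (setAV a b).indicator (fun v => v ^ k - stdLam a b k) v ∂(gaussianReal 0 1)
      = 0 := by
    have : ∀ v, (setAV a b).indicator (fun v => v ^ k - stdLam a b k) v
        = (setAV a b).indicator (fun v => v ^ k) v
          - stdLam a b k * (setAV a b).indicator (1 : ℝ → ℝ) v := by
      intro v
      by_cases hv : v ∈ setAV a b <;> simp [hv]
    have hone : Integrable ((setAV a b).indicator (1 : ℝ → ℝ)) (gaussianReal 0 1) :=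
      (integrable_const (1 : ℝ)).indicator (measurableSet_setAV a b)
    simp_rw [this]
    rw [integral_sub ((memLp_indicator_pow a b k).integrable (by norm_num)) (hone.const_mul _),
      integral_const_mul, integral_indicator_one (measurableSet_setAV a b),
      gaussianReal_real_setAV ha hab hb, stdLam]
    field_simp
    simp
  have ea : ∫ v, (indLe a - fun _ => a : ℝ → ℝ) v * ((PhiInv a).toReal ^ k - stdLam a b k)
      ∂(gaussianReal 0 1) = 0 := by
    rw [integral_mul_const, integral_sub' (integrable_indLe a) (integrable_const a),
      integral_indLe ha (hab.le.trans hb)]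
    simp
  have eb : ∫ v, ((fun _ => b) - indLe b : ℝ → ℝ) v * ((PhiInv b).toReal ^ k - stdLam a b k)
      ∂(gaussianReal 0 1) = 0 := by
    rw [integral_mul_const, integral_sub' (integrable_const b) (integrable_indLe b),
      integral_indLe (ha.trans hab.le) hb]
    simp
  exact ((integral_add (hi0.add hia) hib).trans (congrArg₂ (· + ·)
    ((integral_add hi0 hia).trans (congrArg₂ (· + ·) e0 ea)) eb)).trans (by simp)

variable {Ω : Type*} [MeasurableSpace Ω] {P : Measure Ω} {V W : ℕ → Ω → ℝ}

namespace StdPairs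

variable (h : StdPairs P V W)
include h

lemma memLp_mul {g e : ℝ → ℝ} (hg : Measurable g) (he : Measurable e)
    (hg2 : MemLp g 2 (gaussianReal 0 1)) (he2 : MemLp e 2 (gaussianReal 0 1)) :
    MemLp (fun ω => g (V 0 ω) * e (W 0 ω)) 2 P := by
  have hm : Measurable fun ω => g (V 0 ω) * e (W 0 ω) :=
    (hg.comp (h.measV 0)).mul (he.comp (h.measW 0))
  rw [memLp_two_iff_integrable_sq hm.aestronglyMeasurable]
  simp_rw [mul_pow]
  exact ((h.indepVW 0).comp (hg.pow_const 2) (he.pow_const 2)).integrable_mul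
    ((h.mpV 0).integrable_comp_of_integrable hg2.integrable_sq)
    ((h.mpW 0).integrable_comp_of_integrable he2.integrable_sq)

lemma integral_mul {g e : ℝ → ℝ} (hg : Measurable g) (he : Measurable e) :
    ∫ ω, g (V 0 ω) * e (W 0 ω) ∂P
      = (∫ v, g v ∂(gaussianReal 0 1)) * ∫ w, e w ∂(gaussianReal 0 1) := by
  rw [← h.integral_comp_V 0 hg, ← h.integral_comp_W 0 he]
  exact ((h.indepVW 0).comp hg he).integral_fun_mul_eq_mul_integral
    (hg.comp (h.measV 0)).aestronglyMeasurable (he.comp (h.measW 0)).aestronglyMeasurable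

lemma measurable_pairZ (a b l₁ l₂ : ℝ) (i : ℕ) :
    Measurable fun ω => pairZ a b l₁ l₂ (V i ω, W i ω) :=
  (QuantileCov.measurable_pairZ a b l₁ l₂).comp ((h.measV i).prodMk (h.measW i))

lemma memLp_pairZ (a b l₁ l₂ : ℝ) : MemLp (fun ω => pairZ a b l₁ l₂ (V 0 ω, W 0 ω)) 2 P := by
  rw [memLp_piLp_iff]
  have hid : Measurable ((setAV a b).indicator (id : ℝ → ℝ)) :=
    measurable_id.indicator (measurableSet_setAV a b)
  have hone : Measurable ((setAV a b).indicator (1 : ℝ → ℝ)) :=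
    measurable_one.indicator (measurableSet_setAV a b)
  have hid2 : MemLp ((setAV a b).indicator (id : ℝ → ℝ)) 2 (gaussianReal 0 1) := by
    simpa [Function.id_def] using memLp_indicator_pow a b 1
  have hone2 : MemLp ((setAV a b).indicator (1 : ℝ → ℝ)) 2 (gaussianReal 0 1) := by
    have := memLp_indicator_pow a b 0
    simp only [pow_zero] at this
    exact this
  have e1 : MemLp (fun w : ℝ => w) 2 (gaussianReal 0 1) := by simpa using memLp_pow_gaussianReal 1
  have e2 : MemLp (fun w : ℝ => w ^ 2 - 1) 2 (gaussianReal 0 1) :=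
    (memLp_pow_gaussianReal 2).sub (memLp_const 1)
  intro i
  simp_rw [pairZ_eq]
  fin_cases i
  · exact (memLp_trimRep a b 1 l₁).comp_measurePreserving (h.mpV 0)
  · exact (memLp_trimRep a b 2 l₂).comp_measurePreserving (h.mpV 0)
  · exact h.memLp_mul hid measurable_id hid2 e1
  · exact h.memLp_mul hone measurable_id hone2 e1
  · exact h.memLp_mul hone (by fun_prop) hone2 e2

lemma integral_pairZ [IsProbabilityMeasure P] (ha : 0 ≤ a) (hab : a < b) (hb : b ≤ 1) :
    ∫ ω, pairZ a b (stdLam a b 1) (stdLam a b 2) (V 0 ω, W 0 ω) ∂P = 0 := by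
  have hZ := h.memLp_pairZ a b (stdLam a b 1) (stdLam a b 2)
  have hid : Measurable ((setAV a b).indicator (id : ℝ → ℝ)) :=
    measurable_id.indicator (measurableSet_setAV a b)
  have hone : Measurable ((setAV a b).indicator (1 : ℝ → ℝ)) :=
    measurable_one.indicator (measurableSet_setAV a b)
  have e1 : ∫ w, id w ∂(gaussianReal 0 1) = 0 := by simp [integral_id_gaussianReal]
  have e2 : ∫ w, (w ^ 2 - 1) ∂(gaussianReal 0 1) = 0 := by
    rw [integral_sub (integrable_pow_gaussianReal 2) (integrable_const _),
      integral_sq_gaussianReal]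
    simp
  ext i
  rw [eval_integral_piLp fun i => (memLp_piLp_iff.1 hZ i).integrable (by norm_num)]
  simp_rw [pairZ_eq]
  fin_cases i
  · exact (h.integral_comp_V 0 (measurable_trimRep a b 1 _)).trans (integral_trimRep ha hab hb 1)
  · exact (h.integral_comp_V 0 (measurable_trimRep a b 2 _)).trans (integral_trimRep ha hab hb 2)
  · exact (h.integral_mul hid measurable_id).trans (by rw [e1, mul_zero]; rfl)
  · exact (h.integral_mul hone measurable_id).trans (by rw [e1, mul_zero]; rfl)
  · exact (h.integral_mul hone (e := fun w => w ^ 2 - 1) (by fun_prop)).trans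
      (by rw [e2, mul_zero]; rfl)

/-! ### Conditional moments -/

lemma measureReal_mem_setAV (ha : 0 ≤ a) (hab : a < b) (hb : b ≤ 1) :
    P.real {ω | V 0 ω ∈ setAV a b} = b - a := by
  rw [← gaussianReal_real_setAV ha hab hb, ← (h.mpV 0).measureReal_preimage
    (measurableSet_setAV a b).nullMeasurableSet]
  rfl

lemma isProbabilityMeasure_cond [IsProbabilityMeasure P] (ha : 0 ≤ a) (hab : a < b) (hb : b ≤ 1) :
    IsProbabilityMeasure (ProbabilityTheory.cond P {ω | V 0 ω ∈ setAV a b}) := by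
  refine cond_isProbabilityMeasure fun h0 => ?_
  have := h.measureReal_mem_setAV ha hab hb
  rw [measureReal_def, h0] at this
  simp at this
  linarith

/-- The conditioning event involves `V` only, so `W` remains standard normal and independent of `V`.
-/
lemma integral_cond (ha : 0 ≤ a) (hab : a < b) (hb : b ≤ 1) {g e : ℝ → ℝ}
    (hg : Measurable g) (he : Measurable e) :
    ∫ ω, g (V 0 ω) * e (W 0 ω) ∂(ProbabilityTheory.cond P {ω | V 0 ω ∈ setAV a b})
      = (b - a)⁻¹ * ((∫ v, (setAV a b).indicator g v ∂(gaussianReal 0 1))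
        * ∫ w, e w ∂(gaussianReal 0 1)) := by
  have hs : MeasurableSet {ω | V 0 ω ∈ setAV a b} := h.measV 0 (measurableSet_setAV a b)
  rw [ProbabilityTheory.cond, integral_smul_measure, ← integral_indicator hs, ENNReal.toReal_inv,
    ← measureReal_def, h.measureReal_mem_setAV ha hab hb, smul_eq_mul,
    ← h.integral_mul (hg.indicator (measurableSet_setAV a b)) he]
  congr 2
  ext ω
  by_cases hω : V 0 ω ∈ setAV a b <;> simp [hω]

end StdPairs

end Moments

/-! ### The standardised pair of a bivariate normal sample -/

section Standardise

variable {Ω : Type*} [MeasurableSpace Ω] {P : Measure Ω} [IsProbabilityMeasure P]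

lemma covariance_affine {X Y : Ω → ℝ} (hX : MemLp X 2 P) (hY : MemLp Y 2 P)
    (p q k p' q' k' : ℝ) :
    cov[fun ω => p * X ω + q * Y ω + k, fun ω => p' * X ω + q' * Y ω + k'; P]
      = p * p' * cov[X, X; P] + (p * q' + q * p') * cov[X, Y; P] + q * q' * cov[Y, Y; P] := by
  have h1 {p q : ℝ} : MemLp (fun ω => p * X ω + q * Y ω) 2 P :=
    (hX.const_mul p).add (hY.const_mul q)
  rw [covariance_add_const_left (h1.integrable (by norm_num)),
    covariance_add_const_right (h1.integrable (by norm_num))]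
  change cov[(fun ω => p * X ω) + (fun ω => q * Y ω), (fun ω => p' * X ω) + (fun ω => q' * Y ω); P]
    = _
  have h2 : MemLp ((fun ω => p' * X ω) + fun ω => q' * Y ω) 2 P :=
    (hX.const_mul p').add (hY.const_mul q')
  rw [covariance_add_left (hX.const_mul p) (hY.const_mul q) h2,
    covariance_add_right (hX.const_mul p) (hX.const_mul p') (hY.const_mul q'),
    covariance_add_right (hY.const_mul q) (hX.const_mul p') (hY.const_mul q')]
  simp only [covariance_const_mul_left, covariance_const_mul_right]
  rw [covariance_comm Y X]
  ring

lemma integral_affine {X Y : Ω → ℝ} (hX : Integrable X P) (hY : Integrable Y P) (p q k : ℝ) :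
    ∫ ω, (p * X ω + q * Y ω + k) ∂P = p * ∫ ω, X ω ∂P + q * ∫ ω, Y ω ∂P + k := by
  have h1 : Integrable (fun ω => p * X ω + q * Y ω) P := (hX.const_mul p).add (hY.const_mul q)
  rw [integral_add h1 (integrable_const _),
    integral_add (hX.const_mul p) (hY.const_mul q), integral_const_mul, integral_const_mul]
  simp

omit [IsProbabilityMeasure P] in
-- Joint normality, and not just normal marginals, is what turns zero covariance of `V` and `W` into
-- independence.
lemma hasGaussianLaw_affine_pair {X : Ω → EuclideanSpace ℝ (Fin 2)} (hX : HasGaussianLaw X P)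
    (p q k p' q' k' : ℝ) :
    HasGaussianLaw (fun ω => (p * X ω 0 + q * X ω 1 + k, p' * X ω 0 + q' * X ω 1 + k')) P := by
  let e (j : Fin 2) : EuclideanSpace ℝ (Fin 2) →L[ℝ] ℝ := EuclideanSpace.proj j
  let A : EuclideanSpace ℝ (Fin 2) →L[ℝ] ℝ × ℝ := (p • e 0 + q • e 1).prod (p' • e 0 + q' • e 1)
  have hG := hX.map_fun A
  have := hG.isGaussian_map
  refine ⟨?_⟩
  have hm : P.map (fun ω => (p * X ω 0 + q * X ω 1 + k, p' * X ω 0 + q' * X ω 1 + k'))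
      = (P.map fun ω => A (X ω)).map (fun x => x + (k, k')) := by
    rw [AEMeasurable.map_map_of_aemeasurable (measurable_add_const _).aemeasurable hG.aemeasurable]
    rfl
  rw [hm]
  infer_instance

omit [IsProbabilityMeasure P] in
lemma hasGaussianLaw_measurePreserving {T : Ω → ℝ} (hT : HasGaussianLaw T P) (hm : Measurable T)
    (h0 : ∫ ω, T ω ∂P = 0) (h1 : cov[T, T; P] = 1) : MeasurePreserving T P (gaussianReal 0 1) := by
  refine ⟨hm, ?_⟩
  rw [hT.map_eq_gaussianReal, h0, ← covariance_self hm.aemeasurable, h1, Real.toNNReal_one]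

lemma stdPairs_of_affine {X : ℕ → Ω → EuclideanSpace ℝ (Fin 2)} (hmeas : ∀ i, Measurable (X i))
    (hG : ∀ i, HasGaussianLaw (X i) P) (hindep : iIndepFun X P) {m : Fin 2 → ℝ}
    (hm : ∀ i j, ∫ ω, X i ω j ∂P = m j) {S : Matrix (Fin 2) (Fin 2) ℝ}
    (hS : ∀ i j k, cov[fun ω => X i ω j, fun ω => X i ω k; P] = S j k)
    {V W : ℕ → Ω → ℝ} {p q k p' q' k' : ℝ}
    (hV : V = fun i ω => p * X i ω 0 + q * X i ω 1 + k)
    (hW : W = fun i ω => p' * X i ω 0 + q' * X i ω 1 + k')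
    (hV0 : p * m 0 + q * m 1 + k = 0) (hW0 : p' * m 0 + q' * m 1 + k' = 0)
    (hV1 : p * p * S 0 0 + (p * q + q * p) * S 0 1 + q * q * S 1 1 = 1)
    (hW1 : p' * p' * S 0 0 + (p' * q' + q' * p') * S 0 1 + q' * q' * S 1 1 = 1)
    (hVW : p * p' * S 0 0 + (p * q' + q * p') * S 0 1 + q * q' * S 1 1 = 0) :
    StdPairs P V W := by
  subst hV hW
  have hL (i : ℕ) (j : Fin 2) : MemLp (fun ω => X i ω j) 2 P :=
    memLp_piLp_iff.1 (hG i).memLp_two j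
  have hI (i : ℕ) (j : Fin 2) : Integrable (fun ω => X i ω j) P := (hL i j).integrable (by norm_num)
  have hpair (i : ℕ) := hasGaussianLaw_affine_pair (hG i) p q k p' q' k'
  have hc (i : ℕ) (j : Fin 2) : Measurable fun ω => X i ω j := by
    have := hmeas i
    fun_prop
  have hmV (i : ℕ) (p q k : ℝ) : Measurable fun ω => p * X i ω 0 + q * X i ω 1 + k :=
    (((hc i 0).const_mul p).add ((hc i 1).const_mul q)).add_const k
  have hcov (i : ℕ) (p q k p' q' k' : ℝ) := covariance_affine (hL i 0) (hL i 1) p q k p' q' k'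
  refine ⟨fun i => ?_, fun i => ?_, ?_, fun i => ?_⟩
  · refine hasGaussianLaw_measurePreserving (hpair i).fst (hmV i p q k) ?_ ?_
    · rw [integral_affine (hI i 0) (hI i 1), hm, hm, hV0]
    · rw [hcov, hS, hS, hS, hV1]
  · refine hasGaussianLaw_measurePreserving (hpair i).snd (hmV i p' q' k') ?_ ?_
    · rw [integral_affine (hI i 0) (hI i 1), hm, hm, hW0]
    · rw [hcov, hS, hS, hS, hW1]
  · exact hindep.comp (fun _ x => (p * x 0 + q * x 1 + k, p' * x 0 + q' * x 1 + k'))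
      fun _ => by fun_prop
  · refine (hpair i).indepFun_of_covariance_eq_zero ?_
    rw [hcov, hS, hS, hS, hVW]

lemma exists_angle {x y : ℝ} (h : x ^ 2 + y ^ 2 = 1) :
    ∃ γ ∈ Set.Ico (-Real.pi) Real.pi, Real.cos γ = x ∧ Real.sin γ = y := by
  have hn : ‖(⟨x, y⟩ : ℂ)‖ = 1 := by
    rw [Complex.norm_eq_sqrt_sq_add_sq]
    simp [h]
  have h0 : (⟨x, y⟩ : ℂ) ≠ 0 := fun h0 => by simp [h0] at hn
  have hc := Complex.cos_arg h0
  have hs := Complex.sin_arg ⟨x, y⟩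
  rw [hn, div_one] at hc hs
  obtain ⟨h1, h2⟩ := Complex.arg_mem_Ioc ⟨x, y⟩
  -- The argument lies in `(-π, π]`; the value `π` is exchanged for `-π`.
  rcases h2.eq_or_lt with h2 | h2
  · rw [h2] at hc hs
    exact ⟨-Real.pi, ⟨le_rfl, by linarith [Real.pi_pos]⟩, by simpa using hc, by simpa using hs⟩
  · exact ⟨_, ⟨h1.le, h2⟩, hc, hs⟩

variable {X : ℕ → Ω → EuclideanSpace ℝ (Fin 2)} {m : EuclideanSpace ℝ (Fin 2)} {σ : Fin 2 → ℝ}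
  {r : ℝ}

lemma posSemidef_two {s t r : ℝ} (hs : 0 < s) (h : 0 < s ^ 2 * t ^ 2 - r ^ 2) :
    (!![s ^ 2, r; r, t ^ 2] : Matrix (Fin 2) (Fin 2) ℝ).PosSemidef := by
  refine .of_dotProduct_mulVec_nonneg ?_ fun x => ?_
  · ext i j
    fin_cases i <;> fin_cases j <;> rfl
  · have e : star x ⬝ᵥ (!![s ^ 2, r; r, t ^ 2] : Matrix (Fin 2) (Fin 2) ℝ).mulVec x
        = ((s ^ 2 * x 0 + r * x 1) ^ 2 + (s ^ 2 * t ^ 2 - r ^ 2) * x 1 ^ 2) / s ^ 2 := by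
      simp [dotProduct, Matrix.mulVec, Fin.sum_univ_two]
      field_simp
      ring
    rw [e]
    positivity

/-- The standardised benchmark and its complement are independent standard normal variables, and
the sample is a rotation of them. -/
theorem exists_angle_representation
    (hσ : ∀ j, 0 < σ j) (hρ : r / (σ 0 * σ 1) ∈ Set.Ioo (-1 : ℝ) 1)
    (hmeas : ∀ i, Measurable (X i))
    (hlaw : ∀ i, HasLaw (X i) (multivariateGaussian m !![σ 0 ^ 2, r; r, σ 1 ^ 2]) P)
    (hindep : iIndepFun X P) {α : Fin 2 → ℝ} (hα : α ≠ 0) :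
    StdPairs P (stdV P α X) (stdW P α X) ∧
    (∃ μ τ : ℝ, 0 < τ ∧ ∀ i ω, benchmark α X i ω = μ + τ * stdV P α X i ω) ∧
    ∃ γ : Fin 2 → ℝ, (∀ j, γ j ∈ Set.Ico (-Real.pi) Real.pi) ∧
      ∀ i j ω, X i ω j = m j + σ j * (Real.cos (γ j) * stdV P α X i ω
        + Real.sin (γ j) * stdW P α X i ω) := by
  have hs0 := hσ 0
  have hs1 := hσ 1
  set s := σ 0 with hs
  set t := σ 1 with ht
  have hΔ : 0 < s ^ 2 * t ^ 2 - r ^ 2 := by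
    have h1 : |r / (s * t)| < 1 := abs_lt.2 hρ
    rw [abs_div, abs_of_pos (mul_pos hs0 hs1), div_lt_one (mul_pos hs0 hs1)] at h1
    have := pow_lt_pow_left₀ h1 (abs_nonneg r) two_ne_zero
    rw [sq_abs, mul_pow] at this
    linarith
  set Δ := s ^ 2 * t ^ 2 - r ^ 2 with hΔdef
  set S : Matrix (Fin 2) (Fin 2) ℝ := !![s ^ 2, r; r, t ^ 2] with hSdef
  have hSpos : S.PosSemidef := posSemidef_two hs0 hΔ
  have hG (i : ℕ) : HasGaussianLaw (X i) P := (hlaw i).hasGaussianLaw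
  have hL (i : ℕ) (j : Fin 2) : MemLp (fun ω => X i ω j) 2 P :=
    memLp_piLp_iff.1 (hG i).memLp_two j
  have hI (i : ℕ) (j : Fin 2) : Integrable (fun ω => X i ω j) P := (hL i j).integrable (by norm_num)
  have hm (i : ℕ) (j : Fin 2) : ∫ ω, X i ω j ∂P = m j := by
    rw [← eval_integral_piLp (hI i) j, (hlaw i).integral_eq, integral_id_multivariateGaussian]
  have hS (i : ℕ) (j k : Fin 2) : cov[fun ω => X i ω j, fun ω => X i ω k; P] = S j k := by
    rw [(hlaw i).covariance_fun_comp (f := fun x => x j) (g := fun x => x k)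
      (by fun_prop) (by fun_prop), covariance_eval_multivariateGaussian hSpos]
  -- `c0` and `c1` are the covariances of the benchmark with the two coordinates, `T` is its
  -- variance, and `Δ` is the determinant of the covariance matrix.
  set c0 := α 0 * s ^ 2 + α 1 * r with hc0
  set c1 := α 0 * r + α 1 * t ^ 2 with hc1
  set T := α 0 * c0 + α 1 * c1 with hT
  have hTpos : 0 < T := by
    -- Completing the square in the quadratic form; with `Δ > 0` it shows that the benchmark is
    -- nondegenerate.
    have e : s ^ 2 * T = c0 ^ 2 + Δ * α 1 ^ 2 := by
      rw [hT, hc1, hΔdef, hc0]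
      ring
    have h2 : 0 < s ^ 2 * T := by
      rw [e]
      by_cases h1 : α 1 = 0
      · have h0 : α 0 ≠ 0 := fun h0 => hα (by ext j; fin_cases j <;> simp [h0, h1])
        have : c0 ≠ 0 := by
          rw [hc0, h1]
          simp [h0, hs0.ne']
        positivity
      · positivity
    exact pos_of_mul_pos_right h2 (by positivity)
  have hY (i : ℕ) : benchmark α X i = fun ω => α 0 * X i ω 0 + α 1 * X i ω 1 + 0 := by
    ext ω
    simp [benchmark]
  have hcY (j : Fin 2) : cov[benchmark α X 0, fun ω => X 0 ω j; P] = α 0 * S 0 j + α 1 * S 1 j := by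
    have hadd : benchmark α X 0 = (fun ω => α 0 * X 0 ω 0) + fun ω => α 1 * X 0 ω 1 := rfl
    rw [hadd, covariance_add_left ((hL 0 0).const_mul _) ((hL 0 1).const_mul _) (hL 0 j),
      covariance_const_mul_left, covariance_const_mul_left, hS, hS]
  have hU (i : ℕ) : auxU P α X i = fun ω => c1 * X i ω 0 + (-c0) * X i ω 1 + 0 := by
    ext ω
    simp only [auxU, hcY]
    simp [hSdef, hc0, hc1]
    ring
  have hvar (i : ℕ) (p q : ℝ) : Var[fun ω => p * X i ω 0 + q * X i ω 1 + 0; P]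
      = p * p * s ^ 2 + (p * q + q * p) * r + q * q * t ^ 2 := by
    rw [← covariance_self, covariance_affine (hL i 0) (hL i 1), hS, hS, hS]
    · simp [hSdef]
    · have := (hI i 0).aemeasurable
      have := (hI i 1).aemeasurable
      fun_prop
  have hvY (i : ℕ) : Var[benchmark α X i; P] = T := by
    rw [hY, hvar, hT, hc0, hc1]
    ring
  have hvU (i : ℕ) : Var[auxU P α X i; P] = Δ * T := by
    rw [hU, hvar, hT, hc0, hc1, hΔdef]
    ring
  set u := √T with hu
  set v := √(Δ * T) with hv
  have hu0 : 0 < u := Real.sqrt_pos.2 hTpos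
  have hv0 : 0 < v := Real.sqrt_pos.2 (mul_pos hΔ hTpos)
  have hu2 : u ^ 2 = T := Real.sq_sqrt hTpos.le
  have hv2 : v ^ 2 = Δ * T := Real.sq_sqrt (mul_pos hΔ hTpos).le
  have hV : stdV P α X = fun i ω => α 0 / u * X i ω 0 + α 1 / u * X i ω 1
      + -(α 0 * m 0 + α 1 * m 1) / u := by
    ext i ω
    rw [stdV, standardize, hvY, hY, integral_affine (hI i 0) (hI i 1), hm, hm]
    ring
  have hW : stdW P α X = fun i ω => c1 / v * X i ω 0 + -c0 / v * X i ω 1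
      + -(c1 * m 0 - c0 * m 1) / v := by
    ext i ω
    rw [stdW, standardize, hvU, hU, integral_affine (hI i 0) (hI i 1), hm, hm]
    ring
  have hS00 : S 0 0 = s ^ 2 := rfl
  have hS01 : S 0 1 = r := rfl
  have hS11 : S 1 1 = t ^ 2 := rfl
  refine ⟨?_, ⟨α 0 * m 0 + α 1 * m 1, u, hu0, fun i ω => ?_⟩, ?_⟩
  · refine stdPairs_of_affine hmeas hG hindep (m := fun j => m j) hm hS hV hW ?_ ?_ ?_ ?_ ?_
    · ring
    · ring
    · rw [hS00, hS01, hS11]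
      field_simp
      rw [hu2, hT, hc0, hc1]
      ring
    · rw [hS00, hS01, hS11]
      field_simp
      rw [hv2, hT, hc0, hc1, hΔdef]
      ring
    · rw [hS00, hS01, hS11]
      field_simp
      rw [hc0, hc1]
      ring
  · rw [hV, hY]
    field_simp
    ring
  -- The cosine and sine are the correlations of the coordinate with `V` and `W`. The covariances
  -- with the auxiliary variable are `α 1 * Δ` and `-α 0 * Δ`, and `Δ / v = v / u²`.
  · obtain ⟨g0, hg0, hcos0, hsin0⟩ := exists_angle (x := c0 / (s * u)) (y := α 1 * v / (s * u ^ 2))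
      (by
        field_simp
        rw [show u ^ 4 = (u ^ 2) ^ 2 by ring, hv2, hu2, hT, hc0, hc1, hΔdef]
        ring)
    obtain ⟨g1, hg1, hcos1, hsin1⟩ := exists_angle (x := c1 / (t * u)) (y := -(α 0 * v) / (t * u ^ 2))
      (by
        field_simp
        rw [show u ^ 4 = (u ^ 2) ^ 2 by ring, hv2, hu2, hT, hc0, hc1, hΔdef]
        ring)
    refine ⟨![g0, g1], fun j => ?_, fun i j ω => ?_⟩
    · fin_cases j
      · exact hg0
      · exact hg1
    · rw [hV, hW]
      fin_cases j
      · change X i ω 0 = m 0 + s * (Real.cos g0 * _ + Real.sin g0 * _)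
        rw [hcos0, hsin0]
        field_simp
        rw [hu2, hT]
        ring
      · change X i ω 1 = m 1 + t * (Real.cos g1 * _ + Real.sin g1 * _)
        rw [hcos1, hsin1]
        field_simp
        rw [hu2, hT]
        ring

end Standardise

/-! ### Linearisation of the sample moments -/

section Linearise

open scoped Topology

variable {Ω : Type*} [MeasurableSpace Ω] {P : Measure Ω} {V W : ℕ → Ω → ℝ} {a b : ℝ}

lemma rankedMean_linear (hab : a ≤ b) (hb : b ≤ 1) {n : ℕ} (hn : subsampleSize a b n ≠ 0)
    (y v w : Fin n → ℝ) (p q c s : ℝ) :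
    rankedMean a b y (fun i => p + q * (c * v i + s * w i))
      = p + q * (c * rankedMean a b y v + s * rankedMean a b y w) := by
  rw [rankedMean_add, rankedMean_const hab hb hn, rankedMean_const_mul, rankedMean_add,
    rankedMean_const_mul, rankedMean_const_mul]

/-- The square of `w` enters as `(w² - 1) + 1`, so that the representation for centred functions of
`W` applies. -/
lemma rankedMean_product (hab : a ≤ b) (hb : b ≤ 1) {n : ℕ} (hn : subsampleSize a b n ≠ 0)
    (y v w : Fin n → ℝ) (q c s q' c' s' x z : ℝ) :
    rankedMean a b y (fun i => q * (c * (v i - x) + s * (w i - z))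
        * (q' * (c' * (v i - x) + s' * (w i - z))))
      = q * q' * (c * c' * (rankedMean a b y (fun i => v i ^ 2) - 2 * x * rankedMean a b y v + x ^ 2)
        + (s * c' + c * s') * (rankedMean a b y (fun i => v i * w i) - z * rankedMean a b y v
          - x * rankedMean a b y w + x * z)
        + s * s' * (rankedMean a b y (fun i => w i ^ 2 - 1) + 1 - 2 * z * rankedMean a b y w
          + z ^ 2)) := by
  have e : (fun i => q * (c * (v i - x) + s * (w i - z)) * (q' * (c' * (v i - x) + s' * (w i - z))))
      = fun i => (q * q' * (c * c')) * v i ^ 2 + ((q * q' * (s * c' + c * s')) * (v i * w i)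
        + ((q * q' * (s * s')) * (w i ^ 2 - 1)
        + ((-(q * q' * (2 * c * c' * x + (s * c' + c * s') * z))) * v i
        + ((-(q * q' * (2 * s * s' * z + (s * c' + c * s') * x))) * w i
        + q * q' * (c * c' * x ^ 2 + (s * c' + c * s') * (x * z) + s * s' * (1 + z ^ 2)))))) := by
    ext i
    ring
  rw [e]
  simp only [rankedMean_add, rankedMean_const hab hb hn, rankedMean_const_mul]
  ring

lemma tendsto_inv_sqrt_sqrt_sq_mul (ha : 0 ≤ a) (hab : a < b) :
    Tendsto (fun n : ℕ => ((√√(n : ℝ))⁻¹ * (√n / subsampleSize a b n)) ^ 2 * n) atTop (𝓝 0) := by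
  have h0 : Tendsto (fun n : ℕ => (√(n : ℝ))⁻¹) atTop (𝓝 0) :=
    (Real.tendsto_sqrt_atTop.comp tendsto_natCast_atTop_atTop).inv_tendsto_atTop
  have h := h0.mul ((tendsto_div_subsampleSize ha hab).pow 2)
  rw [zero_mul] at h
  refine h.congr fun n => ?_
  rw [mul_pow, inv_pow, Real.sq_sqrt (Real.sqrt_nonneg _), div_pow, div_pow,
    Real.sq_sqrt (Nat.cast_nonneg n)]
  ring

namespace StdPairs

variable (h : StdPairs P V W)
include h

variable [IsProbabilityMeasure P]

/-- An approximation error of order `n ^ (-1/2)` is null at the scale `n ^ (-1/4)`. -/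
lemma nullSeq_sqrt_sqrt_mul (ha : 0 ≤ a) (hab : a < b) {g : ℝ × ℝ → ℝ} (hg : Measurable g)
    (hg2 : MemLp (fun ω => g (V 0 ω, W 0 ω)) 2 P) (hg0 : ∫ ω, g (V 0 ω, W 0 ω) ∂P = 0)
    {f : ℕ → Ω → ℝ} (hf : NullSeq P (fun n ω => √n * f n ω
      - √n / subsampleSize a b n * ∑ i ∈ Finset.range n, g (V i ω, W i ω))) :
    NullSeq P fun n ω => √√(n : ℝ) * f n ω := by
  have h0 : Tendsto (fun n : ℕ => (√√(n : ℝ))⁻¹) atTop (𝓝 0) :=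
    (Real.tendsto_sqrt_atTop.comp (Real.tendsto_sqrt_atTop.comp
      tendsto_natCast_atTop_atTop)).inv_tendsto_atTop
  have h1 := nullSeq_rpow_mul_sum_iid (h.iIndepFun_comp hg)
    (fun i => (h.identDistrib i).comp hg) hg2 hg0 (tendsto_inv_sqrt_sqrt_sq_mul ha hab)
  refine ((hf.mul_tendsto h0).add h1).congr' ?_
  filter_upwards [eventually_gt_atTop 0] with n hn
  refine ae_of_all _ fun ω => ?_
  have hs : √√(n : ℝ) ≠ 0 := by positivity
  have hsq : √(n : ℝ) = √√(n : ℝ) * √√(n : ℝ) := (Real.mul_self_sqrt (Real.sqrt_nonneg _)).symm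
  calc _ = (√√(n : ℝ))⁻¹ * (√n * f n ω) := by ring
    _ = (√√(n : ℝ))⁻¹ * ((√√(n : ℝ) * √√(n : ℝ)) * f n ω) := by rw [← hsq]
    _ = _ := by field_simp

variable (V W a b) in
omit [MeasurableSpace Ω] [IsProbabilityMeasure P] h in
/-- The scaled sum of the representation variables. -/
noncomputable def repSum (n : ℕ) (ω : Ω) : EuclideanSpace ℝ (Fin 5) :=
  (√n / subsampleSize a b n) •
    ∑ i ∈ Finset.range n, pairZ a b (stdLam a b 1) (stdLam a b 2) (V i ω, W i ω)

omit [MeasurableSpace Ω] [IsProbabilityMeasure P] h in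
lemma repSum_apply (n : ℕ) (ω : Ω) (k : Fin 5) : repSum V W a b n ω k
    = √n / subsampleSize a b n *
      ∑ i ∈ Finset.range n, pairZ a b (stdLam a b 1) (stdLam a b 2) (V i ω, W i ω) k := by
  simp [repSum]

lemma nullSeq_mean_V (ha : 0 ≤ a) (hab : a < b) (hb : b ≤ 1) :
    NullSeq P fun n ω => √n * (rankedMean a b (fun i : Fin n => V i ω) (fun i : Fin n => V i ω)
      - stdLam a b 1) - repSum V W a b n ω 0 := by
  have := h.nullSeq_rankedMean_pow ha hab hb 1 (stdLam a b 1)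
  simp_rw [pow_one] at this
  simp_rw [repSum_apply]
  exact this

lemma nullSeq_mean_V_sq (ha : 0 ≤ a) (hab : a < b) (hb : b ≤ 1) :
    NullSeq P fun n ω => √n * (rankedMean a b (fun i : Fin n => V i ω)
      (fun i : Fin n => V i ω ^ 2) - stdLam a b 2) - repSum V W a b n ω 1 := by
  simp_rw [repSum_apply]
  exact h.nullSeq_rankedMean_pow ha hab hb 2 (stdLam a b 2)

lemma nullSeq_mean_VW (ha : 0 ≤ a) (hab : a < b) (hb : b ≤ 1) :
    NullSeq P fun n ω => √n * rankedMean a b (fun i : Fin n => V i ω)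
      (fun i : Fin n => V i ω * W i ω) - repSum V W a b n ω 2 := by
  simp_rw [repSum_apply]
  exact h.nullSeq_rankedMean_cross ha hab hb (g := id) (e := id) measurable_id
    (integrable_pow_gaussianReal 4) measurable_id
    (by simpa [Function.id_def] using memLp_pow_gaussianReal 1) (by simp [integral_id_gaussianReal])

lemma nullSeq_mean_W (ha : 0 ≤ a) (hab : a < b) (hb : b ≤ 1) :
    NullSeq P fun n ω => √n * rankedMean a b (fun i : Fin n => V i ω) (fun i : Fin n => W i ω)
      - repSum V W a b n ω 3 := by
  simp_rw [repSum_apply]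
  have := h.nullSeq_rankedMean_cross ha hab hb (g := fun _ => 1) (e := id) measurable_const
    (integrable_const _) measurable_id
    (by simpa [Function.id_def] using memLp_pow_gaussianReal 1) (by simp [integral_id_gaussianReal])
  simp_rw [one_mul] at this
  exact this

lemma nullSeq_mean_W_sq (ha : 0 ≤ a) (hab : a < b) (hb : b ≤ 1) :
    NullSeq P fun n ω => √n * rankedMean a b (fun i : Fin n => V i ω)
      (fun i : Fin n => W i ω ^ 2 - 1) - repSum V W a b n ω 4 := by
  simp_rw [repSum_apply]
  have := h.nullSeq_rankedMean_cross ha hab hb (g := fun _ => 1) (e := fun w => w ^ 2 - 1)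
    measurable_const (integrable_const _) (by fun_prop)
    ((memLp_pow_gaussianReal 2).sub (memLp_const _)) (by
      rw [integral_sub (integrable_pow_gaussianReal 2) (integrable_const _),
        integral_sq_gaussianReal]
      simp)
  simp_rw [one_mul] at this
  exact this

/-- A rate for single deviations: two errors that are null at scale `n^(-1/4)` have a product that
is null at scale `n^(-1/2)`. -/
lemma nullSeq_sqrt_sqrt_mul_of_repSum (ha : 0 ≤ a) (hab : a < b) (hb : b ≤ 1) (k : Fin 5)
    {f : ℕ → Ω → ℝ} (hf : NullSeq P fun n ω => √n * f n ω - repSum V W a b n ω k) :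
    NullSeq P fun n ω => √√(n : ℝ) * f n ω := by
  have hL := h.memLp_pairZ a b (stdLam a b 1) (stdLam a b 2)
  have hm := QuantileCov.measurable_pairZ a b (stdLam a b 1) (stdLam a b 2)
  simp_rw [repSum_apply] at hf
  refine h.nullSeq_sqrt_sqrt_mul ha hab
    (g := fun p => pairZ a b (stdLam a b 1) (stdLam a b 2) p k)
    ((by fun_prop : Measurable fun x : EuclideanSpace ℝ (Fin 5) => x k).comp hm)
    (memLp_piLp_iff.1 hL k) ?_ hf
  have h0 := congrArg (fun x : EuclideanSpace ℝ (Fin 5) => x k) (h.integral_pairZ ha hab hb)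
  simp only [eval_integral_piLp fun i => (memLp_piLp_iff.1 hL i).integrable (by norm_num)] at h0
  exact h0

/-- The ranked mean of a rotated sample is asymptotically linear. -/
theorem nullSeq_linear (ha : 0 ≤ a) (hab : a < b) (hb : b ≤ 1) (p q g : ℝ) :
    NullSeq P fun n ω => √n * (rankedMean a b (fun i : Fin n => V i ω)
        (fun i : Fin n => p + q * (Real.cos g * V i ω + Real.sin g * W i ω))
      - (p + q * (Real.cos g * stdLam a b 1))) - meanLimit q g (repSum V W a b n ω) := by
  refine (((h.nullSeq_mean_V ha hab hb).const_mul (q * Real.cos g)).add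
    ((h.nullSeq_mean_W ha hab hb).const_mul (q * Real.sin g))).congr' ?_
  filter_upwards [eventually_subsampleSize_ne_zero ha hab] with n hn
  refine ae_of_all _ fun ω => ?_
  dsimp only
  rw [rankedMean_linear hab.le hb hn, meanLimit]
  ring

/-- The ranked covariance of a rotated sample is asymptotically linear. -/
theorem nullSeq_product (ha : 0 ≤ a) (hab : a < b) (hb : b ≤ 1) (q g : Fin 2 → ℝ) :
    NullSeq P fun n ω => √n * (rankedMean a b (fun i : Fin n => V i ω)
        (fun i : Fin n => q 0 * (Real.cos (g 0)
            * (V i ω - rankedMean a b (fun i : Fin n => V i ω) (fun i : Fin n => V i ω))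
          + Real.sin (g 0)
            * (W i ω - rankedMean a b (fun i : Fin n => V i ω) (fun i : Fin n => W i ω)))
          * (q 1 * (Real.cos (g 1)
            * (V i ω - rankedMean a b (fun i : Fin n => V i ω) (fun i : Fin n => V i ω))
          + Real.sin (g 1)
            * (W i ω - rankedMean a b (fun i : Fin n => V i ω) (fun i : Fin n => W i ω)))))
      - q 0 * q 1 * (Real.cos (g 0) * Real.cos (g 1) * (stdLam a b 2 - stdLam a b 1 ^ 2)
        + Real.sin (g 0) * Real.sin (g 1)))
      - covLimit q g (stdLam a b 1) (repSum V W a b n ω) := by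
  have hV := h.nullSeq_mean_V ha hab hb
  have hW := h.nullSeq_mean_W ha hab hb
  have hV' := h.nullSeq_sqrt_sqrt_mul_of_repSum ha hab hb 0 hV
  have hW' := h.nullSeq_sqrt_sqrt_mul_of_repSum ha hab hb 3 hW
  -- Expansion of the squared mean `M` of `V` around `l = stdLam a b 1`: `M² - l² = 2 l (M - l) + (M
  -- - l)²`, with a null quadratic part. `hB` and `hC` treat the products with the mean of `W`
  -- likewise.
  have hA := ((h.nullSeq_mean_V_sq ha hab hb).sub (hV.const_mul (2 * stdLam a b 1))).sub
    (hV'.mul hV')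
  have hB := ((h.nullSeq_mean_VW ha hab hb).sub (hW.const_mul (stdLam a b 1))).sub (hV'.mul hW')
  have hC := (h.nullSeq_mean_W_sq ha hab hb).sub (hW'.mul hW')
  refine (((hA.const_mul (q 0 * q 1 * (Real.cos (g 0) * Real.cos (g 1)))).add
    (hB.const_mul (q 0 * q 1 * Real.sin (g 0 + g 1)))).add
    (hC.const_mul (q 0 * q 1 * (Real.sin (g 0) * Real.sin (g 1))))).congr' ?_
  filter_upwards [eventually_subsampleSize_ne_zero ha hab] with n hn
  refine ae_of_all _ fun ω => ?_
  dsimp only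
  have hsq : √(n : ℝ) = √√(n : ℝ) * √√(n : ℝ) := (Real.mul_self_sqrt (Real.sqrt_nonneg _)).symm
  rw [rankedMean_product hab.le hb hn, covLimit, Real.sin_add]
  generalize √√(n : ℝ) = t at *
  simp only [hsq]
  ring

end StdPairs

end Linearise

/-! ### Conditional moments of a rotated pair -/

section Conditional

variable {Ω : Type*} [MeasurableSpace Ω] {P : Measure Ω} {V W : ℕ → Ω → ℝ} {a b : ℝ}

namespace StdPairs

variable (h : StdPairs P V W)
include h

lemma memLp_cond {f : ℝ → ℝ} {T : Ω → ℝ} (hT : MeasurePreserving T P (gaussianReal 0 1))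
    (hf : MemLp f 2 (gaussianReal 0 1)) (ha : 0 ≤ a) (hab : a < b) (hb : b ≤ 1) :
    MemLp (fun ω => f (T ω)) 2 (ProbabilityTheory.cond P {ω | V 0 ω ∈ setAV a b}) := by
  refine ((hf.comp_measurePreserving hT).restrict _).smul_measure (ENNReal.inv_ne_top.2 fun h0 => ?_)
  have := h.measureReal_mem_setAV ha hab hb
  rw [measureReal_def, h0] at this
  simp at this
  linarith

variable [IsProbabilityMeasure P]

omit [IsProbabilityMeasure P] in
lemma integral_cond_V_pow (ha : 0 ≤ a) (hab : a < b) (hb : b ≤ 1) (k : ℕ) :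
    ∫ ω, V 0 ω ^ k ∂(ProbabilityTheory.cond P {ω | V 0 ω ∈ setAV a b}) = stdLam a b k := by
  have := h.integral_cond ha hab hb (g := fun v => v ^ k) (e := fun _ => 1) (by fun_prop)
    measurable_const
  simpa [stdLam] using this

omit [IsProbabilityMeasure P] in
lemma integral_cond_W (ha : 0 ≤ a) (hab : a < b) (hb : b ≤ 1) {e : ℝ → ℝ} (he : Measurable e) :
    ∫ ω, e (W 0 ω) ∂(ProbabilityTheory.cond P {ω | V 0 ω ∈ setAV a b})
      = ∫ w, e w ∂(gaussianReal 0 1) := by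
  have := h.integral_cond ha hab hb (g := 1) measurable_one he
  rw [integral_indicator_one (measurableSet_setAV a b), gaussianReal_real_setAV ha hab hb,
    inv_mul_cancel_left₀ (sub_pos.2 hab).ne'] at this
  simpa using this

lemma integral_cond_linear (ha : 0 ≤ a) (hab : a < b) (hb : b ≤ 1) (p q c s : ℝ) :
    ∫ ω, (p + q * (c * V 0 ω + s * W 0 ω)) ∂(ProbabilityTheory.cond P {ω | V 0 ω ∈ setAV a b})
      = p + q * (c * stdLam a b 1) := by
  have := h.isProbabilityMeasure_cond ha hab hb
  have hid : MemLp id 2 (gaussianReal 0 1) := by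
    simpa [Function.id_def] using memLp_pow_gaussianReal 1
  have hV := (h.memLp_cond (h.mpV 0) hid ha hab hb).integrable (by norm_num)
  have hW := (h.memLp_cond (h.mpW 0) hid ha hab hb).integrable (by norm_num)
  have e : (fun ω => p + q * (c * V 0 ω + s * W 0 ω))
      = fun ω => q * c * V 0 ω + q * s * W 0 ω + p := by
    ext ω
    ring
  have hV1 := h.integral_cond_V_pow ha hab hb 1
  simp_rw [pow_one] at hV1
  have hW1 := h.integral_cond_W ha hab hb measurable_id
  simp only [id_eq, integral_id_gaussianReal] at hV hW hW1
  rw [e, integral_affine hV hW, hV1, hW1]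
  ring

/-- Conditionally on `V ∈ setAV a b`, the variables `V` and `W` stay uncorrelated and `W` keeps unit
variance; only the variance of `V` changes. -/
lemma covariance_cond_linear (ha : 0 ≤ a) (hab : a < b) (hb : b ≤ 1) (p q c s p' q' c' s' : ℝ) :
    cov[fun ω => p + q * (c * V 0 ω + s * W 0 ω), fun ω => p' + q' * (c' * V 0 ω + s' * W 0 ω);
        ProbabilityTheory.cond P {ω | V 0 ω ∈ setAV a b}]
      = q * q' * (c * c' * (stdLam a b 2 - stdLam a b 1 ^ 2) + s * s') := by
  have := h.isProbabilityMeasure_cond ha hab hb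
  have hid : MemLp id 2 (gaussianReal 0 1) := by
    simpa [Function.id_def] using memLp_pow_gaussianReal 1
  have hV := h.memLp_cond (h.mpV 0) hid ha hab hb
  have hW := h.memLp_cond (h.mpW 0) hid ha hab hb
  simp only [id_eq] at hV hW
  have e (p q c s : ℝ) : (fun ω => p + q * (c * V 0 ω + s * W 0 ω))
      = fun ω => q * c * V 0 ω + q * s * W 0 ω + p := by
    ext ω
    ring
  have hV1 := h.integral_cond_V_pow ha hab hb 1
  have hV2 := h.integral_cond_V_pow ha hab hb 2
  simp_rw [pow_one] at hV1
  have hW1 := h.integral_cond_W ha hab hb measurable_id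
  have hW2 := h.integral_cond_W ha hab hb (e := fun w => w ^ 2) (by fun_prop)
  have hVW := h.integral_cond ha hab hb measurable_id measurable_id
  simp only [id_eq, integral_id_gaussianReal, mul_zero] at hW1 hVW
  rw [integral_sq_gaussianReal] at hW2
  rw [e, e, covariance_affine hV hW, covariance_eq_sub hV hV, covariance_eq_sub hV hW,
    covariance_eq_sub hW hW]
  simp only [Pi.mul_apply, ← pow_two, hV1, hV2, hW1, hW2, hVW]
  ring

end StdPairs

lemma hasGaussianLaw_meanLimit {Ω' : Type*} [MeasurableSpace Ω'] {Q : Measure Ω'}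
    {L : Ω' → EuclideanSpace ℝ (Fin 5)} (hL : HasGaussianLaw L Q) (q g : ℝ) :
    HasGaussianLaw (fun ω' => meanLimit q g (L ω')) Q := by
  let e (j : Fin 5) : EuclideanSpace ℝ (Fin 5) →L[ℝ] ℝ := EuclideanSpace.proj j
  exact hL.map_fun (q • (Real.cos g • e 0 + Real.sin g • e 3))

lemma hasGaussianLaw_covLimit {Ω' : Type*} [MeasurableSpace Ω'] {Q : Measure Ω'}
    {L : Ω' → EuclideanSpace ℝ (Fin 5)} (hL : HasGaussianLaw L Q) (q g : Fin 2 → ℝ) (l : ℝ) :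
    HasGaussianLaw (fun ω' => covLimit q g l (L ω')) Q := by
  let e (j : Fin 5) : EuclideanSpace ℝ (Fin 5) →L[ℝ] ℝ := EuclideanSpace.proj j
  exact hL.map_fun ((q 0 * q 1) • ((Real.cos (g 0) * Real.cos (g 1)) • (e 1 - (2 * l) • e 0)
    + Real.sin (g 0 + g 1) • (e 2 - l • e 3) + (Real.sin (g 0) * Real.sin (g 1)) • e 4))

lemma continuous_meanLimit (q g : ℝ) : Continuous (meanLimit q g) := by
  unfold meanLimit
  fun_prop

lemma continuous_covLimit (q g : Fin 2 → ℝ) (l : ℝ) : Continuous (covLimit q g l) := by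
  unfold covLimit
  fun_prop

end Conditional

/-! ### The sample moments -/

section Sample

variable {Ω : Type*} [MeasurableSpace Ω] {P : Measure Ω}
  {X : ℕ → Ω → EuclideanSpace ℝ (Fin 2)} {m : EuclideanSpace ℝ (Fin 2)} {σ γ α : Fin 2 → ℝ}
  {a b : ℝ}

lemma measurable_sampleMean (hmeas : ∀ i, Measurable (X i)) (hab : a ≤ b) (j : Fin 2) (n : ℕ) :
    Measurable (sampleMean α X a b j n) := by
  refine measurable_rankedMean hab (measurable_pi_iff.2 fun k => ?_)
    (measurable_pi_iff.2 fun k => ?_)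
  all_goals
    have := hmeas k
    try unfold benchmark
    fun_prop

lemma measurable_sampleCov (hmeas : ∀ i, Measurable (X i)) (hab : a ≤ b) (n : ℕ) :
    Measurable (sampleCov α X a b n) := by
  have h0 := measurable_sampleMean (α := α) hmeas hab 0 n
  have h1 := measurable_sampleMean (α := α) hmeas hab 1 n
  refine measurable_rankedMean hab (measurable_pi_iff.2 fun k => ?_)
    (measurable_pi_iff.2 fun k => ?_)
  all_goals
    have := hmeas k
    try unfold benchmark
    fun_prop

variable [IsProbabilityMeasure P] (h : StdPairs P (stdV P α X) (stdW P α X))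
  (hrep : ∀ i j ω, X i ω j = m j + σ j * (Real.cos (γ j) * stdV P α X i ω
    + Real.sin (γ j) * stdW P α X i ω))
  {μ τ : ℝ} (hτ : 0 < τ) (hbench : ∀ i ω, benchmark α X i ω = μ + τ * stdV P α X i ω)

include h

omit [IsProbabilityMeasure P] in
lemma lam_eq_stdLam (ha : 0 ≤ a) (hab : a < b) (hb : b ≤ 1) (k : ℕ) :
    lam P α X a b k = stdLam a b k :=
  h.integral_cond_V_pow ha hab hb k

omit [IsProbabilityMeasure P] in
lemma repZ_eq_pairZ (ha : 0 ≤ a) (hab : a < b) (hb : b ≤ 1) (i : ℕ) (ω : Ω) :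
    repZ P α X a b i ω
      = pairZ a b (stdLam a b 1) (stdLam a b 2) (stdV P α X i ω, stdW P α X i ω) := by
  rw [← lam_eq_stdLam h ha hab hb, ← lam_eq_stdLam h ha hab hb]
  rfl

include hτ hbench

omit [IsProbabilityMeasure P] in
-- Quantile sets are equivariant under increasing affine maps, so both conditioning events are the
-- same set.
lemma condLaw_eq : condLaw P α X a b
    = ProbabilityTheory.cond P {ω | stdV P α X 0 ω ∈ setAV a b} := by
  have hmap : P.map (benchmark α X 0) = (gaussianReal 0 1).map fun v => μ + τ * v := by
    rw [← (h.mpV 0).map_eq, Measure.map_map (by fun_prop) (h.measV 0)]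
    congr 1
    ext ω
    exact hbench 0 ω
  rw [condLaw]
  congr 1
  ext ω
  change benchmark α X 0 ω ∈ quantileSet (P.map (benchmark α X 0)) a b ↔ _
  rw [hmap, hbench, mem_quantileSet_map_affine hτ]
  rfl

omit h [IsProbabilityMeasure P] in
lemma rankedMean_benchmark (n : ℕ) (ω : Ω) (z : Fin n → ℝ) :
    rankedMean a b (fun k : Fin n => benchmark α X k ω) z
      = rankedMean a b (fun k : Fin n => stdV P α X k ω) z := by
  simp_rw [hbench]
  exact rankedMean_affine hτ a b _ z

include hrep

lemma condMean_eq (ha : 0 ≤ a) (hab : a < b) (hb : b ≤ 1) (j : Fin 2) :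
    condMean P α X a b j = m j + σ j * (Real.cos (γ j) * stdLam a b 1) := by
  rw [condMean, condLaw_eq h hτ hbench]
  simp_rw [hrep]
  exact h.integral_cond_linear ha hab hb _ _ _ _

lemma condCov_eq (ha : 0 ≤ a) (hab : a < b) (hb : b ≤ 1) :
    condCov P α X a b = σ 0 * σ 1 * (Real.cos (γ 0) * Real.cos (γ 1)
      * (stdLam a b 2 - stdLam a b 1 ^ 2) + Real.sin (γ 0) * Real.sin (γ 1)) := by
  rw [condCov, condLaw_eq h hτ hbench]
  simp_rw [hrep]
  exact h.covariance_cond_linear ha hab hb _ _ _ _ _ _ _ _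

lemma nullSeq_sampleMean (ha : 0 ≤ a) (hab : a < b) (hb : b ≤ 1) (j : Fin 2) :
    NullSeq P fun n ω => √n * (sampleMean α X a b j n ω - condMean P α X a b j)
      - meanLimit (σ j) (γ j) (StdPairs.repSum (stdV P α X) (stdW P α X) a b n ω) := by
  simp_rw [condMean_eq h hrep hτ hbench ha hab hb, sampleMean, rankedMean_benchmark hτ hbench, hrep]
  exact h.nullSeq_linear ha hab hb _ _ _

lemma nullSeq_sampleCov (ha : 0 ≤ a) (hab : a < b) (hb : b ≤ 1) :
    NullSeq P fun n ω => √n * (sampleCov α X a b n ω - condCov P α X a b)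
      - covLimit σ γ (stdLam a b 1)
        (StdPairs.repSum (stdV P α X) (stdW P α X) a b n ω) := by
  refine (h.nullSeq_product ha hab hb σ γ).congr' ?_
  filter_upwards [eventually_subsampleSize_ne_zero ha hab] with n hn
  refine ae_of_all _ fun ω => ?_
  -- The location parameters cancel between an observation and its ranked mean, since a nonempty
  -- subsample averages constants to themselves.
  simp_rw [condCov_eq h hrep hτ hbench ha hab hb, sampleCov, sampleMean,
    rankedMean_benchmark hτ hbench, hrep, rankedMean_linear hab.le hb hn]
  congr 4
  ext i
  ring

end Sample

end QuantileCov

/-! ### The limit theorem -/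

theorem mainTheorem2 {Ω : Type*} [MeasurableSpace Ω] (P : Measure Ω) [IsProbabilityMeasure P]
    (X : ℕ → Ω → EuclideanSpace ℝ (Fin 2))
    (m : EuclideanSpace ℝ (Fin 2)) (σ : Fin 2 → ℝ) (r : ℝ)
    (hσ : ∀ j, 0 < σ j) (hρ : r / (σ 0 * σ 1) ∈ Set.Ioo (-1 : ℝ) 1)
    (hmeas : ∀ i, Measurable (X i))
    (hlaw : ∀ i, HasLaw (X i) (multivariateGaussian m !![σ 0 ^ 2, r; r, σ 1 ^ 2]) P)
    (hindep : iIndepFun X P)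
    (α : Fin 2 → ℝ) (hα : α ≠ 0)
    (a b : ℝ) (ha : 0 ≤ a) (hab : a < b) (hb : b ≤ 1) :
    (QuantileCov.limitCov P α X a b).PosSemidef ∧
    ∃ γ : Fin 2 → ℝ, (∀ j, γ j ∈ Set.Ico (-Real.pi) Real.pi) ∧
      (∀ i j ω, X i ω j = m j + σ j * (Real.cos (γ j) * QuantileCov.stdV P α X i ω
        + Real.sin (γ j) * QuantileCov.stdW P α X i ω)) ∧
      ∀ {Ω' : Type*} [MeasurableSpace Ω'] (Q : Measure Ω') [IsProbabilityMeasure Q]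
        (L : Ω' → EuclideanSpace ℝ (Fin 5)),
        HasLaw L (multivariateGaussian 0 (QuantileCov.limitCov P α X a b)) Q →
        TendstoInDistribution
          (fun (n : ℕ) ω => (Real.sqrt n / (QuantileCov.subsampleSize a b n : ℝ)) •
            ∑ i ∈ Finset.range n, QuantileCov.repZ P α X a b i ω)
          atTop L (fun _ => P) Q ∧
        (∀ j, TendstoInDistribution
          (fun (n : ℕ) ω => Real.sqrt n *
            (QuantileCov.sampleMean α X a b j n ω - QuantileCov.condMean P α X a b j))
          atTop (fun ω' => QuantileCov.meanLimit (σ j) (γ j) (L ω')) (fun _ => P) Q) ∧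
        TendstoInDistribution
          (fun (n : ℕ) ω => Real.sqrt n *
            (QuantileCov.sampleCov α X a b n ω - QuantileCov.condCov P α X a b))
          atTop
          (fun ω' => QuantileCov.covLimit σ γ (QuantileCov.lam P α X a b 1) (L ω'))
          (fun _ => P) Q ∧
        (∀ j, HasGaussianLaw (fun ω' => QuantileCov.meanLimit (σ j) (γ j) (L ω')) Q) ∧
        HasGaussianLaw
          (fun ω' => QuantileCov.covLimit σ γ (QuantileCov.lam P α X a b 1) (L ω')) Q := by
  obtain ⟨h, ⟨μ, τ, hτ, hbench⟩, γ, hγ, hrep⟩ :=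
    QuantileCov.exists_angle_representation hσ hρ hmeas hlaw hindep hα
  have hZ := QuantileCov.repZ_eq_pairZ h ha hab hb
  have hpos := sub_pos.2 hab
  have hL2 : MemLp (QuantileCov.repZ P α X a b 0) 2 P := by
    rw [funext (hZ 0)]
    exact h.memLp_pairZ a b _ _
  refine ⟨QuantileCov.posSemidef_covariance hL2 (by positivity), γ, hγ, hrep, ?_⟩
  intro Ω' _ Q _ L hL
  have hS : QuantileCov.limitCov P α X a b = Matrix.of fun k l => (1 / (b - a)) ^ 2 *
      cov[fun ω => QuantileCov.repZ P α X a b 0 ω k, fun ω => QuantileCov.repZ P α X a b 0 ω l; P] := by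
    rw [QuantileCov.limitCov, one_div_pow]
  have hpair := QuantileCov.measurable_pairZ a b (QuantileCov.stdLam a b 1)
    (QuantileCov.stdLam a b 2)
  have hZ' : QuantileCov.repZ P α X a b = fun i ω => QuantileCov.pairZ a b
      (QuantileCov.stdLam a b 1) (QuantileCov.stdLam a b 2)
      (QuantileCov.stdV P α X i ω, QuantileCov.stdW P α X i ω) := by
    ext1 i
    ext1 ω
    exact hZ i ω
  have hclt : TendstoInDistribution
      (fun (n : ℕ) ω => (√n / (QuantileCov.subsampleSize a b n : ℝ)) •
        ∑ i ∈ Finset.range n, QuantileCov.repZ P α X a b i ω) atTop L (fun _ => P) Q := by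
    refine QuantileCov.tendstoInDistribution_smul_sum_multivariateGaussian
      (c := 1 / (b - a)) ?_ ?_ ?_ hL2 ?_ (by positivity) ?_ (hS ▸ hL)
    · rw [hZ']
      exact h.iIndepFun_comp hpair
    · rw [hZ']
      exact fun i => (h.identDistrib i).comp hpair
    · rw [hZ']
      exact h.measurable_pairZ a b _ _
    · rw [hZ']
      exact h.integral_pairZ ha hab hb
    -- The normalisation times `√n` is `n / m_n → 1 / (b - a)`, whose square is the factor in
    -- `limitCov`.
    · refine (QuantileCov.tendsto_div_subsampleSize ha hab).congr fun n => ?_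
      rw [div_mul_eq_mul_div, Real.mul_self_sqrt (Nat.cast_nonneg n)]
  have hG : TendstoInDistribution
      (QuantileCov.StdPairs.repSum (QuantileCov.stdV P α X) (QuantileCov.stdW P α X) a b)
      atTop L (fun _ => P) Q := by
    rw [hZ'] at hclt
    exact hclt
  refine ⟨hclt, fun j => ?_, ?_, fun j => QuantileCov.hasGaussianLaw_meanLimit hL.hasGaussianLaw _ _,
    QuantileCov.hasGaussianLaw_covLimit hL.hasGaussianLaw _ _ _⟩
  -- Continuous mapping gives the limit of the linear part; the null remainder is then removed by
  -- Slutsky's theorem.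
  · have hc := hG.continuous_comp (QuantileCov.continuous_meanLimit (σ j) (γ j))
    exact tendstoInDistribution_of_tendstoInMeasure_sub _ _ hc
      (QuantileCov.nullSeq_sampleMean h hrep hτ hbench ha hab hb j).tendstoInMeasure
      fun n => (((QuantileCov.measurable_sampleMean hmeas hab.le j n).sub_const _).const_mul
        _).aemeasurable
  · rw [QuantileCov.lam_eq_stdLam h ha hab hb]
    have hc := hG.continuous_comp (QuantileCov.continuous_covLimit σ γ (QuantileCov.stdLam a b 1))
    exact tendstoInDistribution_of_tendstoInMeasure_sub _ _ hc
      (QuantileCov.nullSeq_sampleCov h hrep hτ hbench ha hab hb).tendstoInMeasure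
      fun n => (((QuantileCov.measurable_sampleCov hmeas hab.le n).sub_const _).const_mul
        _).aemeasurable
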